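/- Let $\mathcal{A}=\{H_1,\dots,H_m\}$ be a multiarrangement of $m$ linear hyperplanes in $\mathbb{C}^n$ (repetitions allowed), with nonzero normal vectors $\alpha_1,\dots,\alpha_m$. For $S\subseteq\{1,\dots,m\}$ let $\mathrm{rk}(S)$ be the dimension of the span of $\{\alpha_i : i\in S\}$, let $r=\mathrm{rk}(\{1,\dots,m\})$ be the rank of $\mathcal{A}$, and let $\chi_{\mathcal{A}}(z)=\sum_{S\subseteq\{1,\dots,m\}}(-1)^{|S|}z^{\,r-\mathrm{rk}(S)}$ be the characteristic polynomial of (the matroid of) $\mathcal{A}$. For a line $L=\mathbb{C}\cdot(\ell_1,\dots,\ell_n)\subseteq\mathbb{C}^n$ through the origin put $\lambda_L=\ell_1x_1+\cdots+\ell_nx_n$ (defined up to a nonzero scalar) and $\rho_{\mathcal{A}}(L)=\#\{i : L\not\subseteq H_i\}$. For an integer $k\ge 0$ let $$J_{\mathcal{A},k}=\bigl(\lambda_L^{\rho_{\mathcal{A}}(L)+k} : L\subseteq\mathbb{C}^n \text{ a line}\bigr)\subseteq\mathbb{C}[x_1,\dots,x_n],\qquad J'_{\mathcal{A}}=\bigl(\lambda_L^{\max(\rho_{\mathcal{A}}(L),1)}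 : L\subseteq\mathbb{C}^n \text{ a line}\bigr).$$ Let $\Omega_n=\mathbb{C}[x_1,\dots,x_n]\otimes\wedge\{\theta_1,\dots,\theta_n\}$, bigraded by $\deg x_i=(1,0)$ and $\deg\theta_i=(0,1)$, with the operator $df=\sum_{i}(\partial f/\partial x_i)\cdot\theta_i$. Let $I_{\mathcal{A}}\subseteq\Omega_n$ be the smallest two-sided ideal that contains $J_{\mathcal{A},1}$ and is closed under $d$, and let $\mathcal{E}_{\mathcal{A}}=\Omega_n/I_{\mathcal{A}}$, with bigraded Hilbert series $\mathrm{Hilb}(\mathcal{E}_{\mathcal{A}};q,t)=\sum_{i,j\ge 0}\dim_{\mathbb{C}}(\mathcal{E}_{\mathcal{A}})_{i,j}\,q^it^j$. Then $\mathrm{Hilb}(\mathcal{E}_{\mathcal{A}};q,t)$ is a polynomial in $\mathbb{N}[q,t]$, and the following hold. 1. $\mathrm{Hilb}(\mathcal{E}_{\mathcal{A}};q,0)=\mathrm{Hilb}(\mathbb{C}[x_1,\dots,x_n]/J_{\mathcal{A},1};q)$, the Hilbert series of the external zonotopal algebra. 2. If $r=n$, then the coefficient $[t^r]\,\mathrm{Hilb}(\mathcal{E}_{\mathcal{A}};q,t)$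 equals $\mathrm{Hilb}(\mathbb{C}[x_1,\dots,x_n]/J_{\mathcal{A},0};q)$, the Hilbert series of the central zonotopal algebra. For arbitrary $r\le n$, $[t^r]\,\mathrm{Hilb}(\mathcal{E}_{\mathcal{A}};q,t)=\mathrm{Hilb}(\mathbb{C}[x_1,\dots,x_n]/J'_{\mathcal{A}};q)$, where $\mathbb{C}[x_1,\dots,x_n]/J'_{\mathcal{A}}$ is the central zonotopal algebra of the essentialization of $\mathcal{A}$ (and $J'_{\mathcal{A}}=J_{\mathcal{A},0}$ when $r=n$). 3. The summand $\operatorname{top}(\mathcal{A})$ of maximal total degree in $\mathrm{Hilb}(\mathcal{E}_{\mathcal{A}};q,t)$ is $$\operatorname{top}(\mathcal{A})=(-1)^r q^{m-r}t^r\chi_{\mathcal{A}}\!\left(-\frac{q}{t}\right).$$ -/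

import Mathlib

open scoped TensorProduct

noncomputable section

/-- A multiarrangement of `m` linear hyperplanes in `ℂⁿ`, given by a choice of nonzero normal
vectors. Repetitions are allowed. -/
structure Multiarrangement (n m : ℕ) where
  normal : Fin m → Fin n → ℂ
  normal_ne_zero : ∀ i, normal i ≠ 0

namespace Multiarrangement

variable {n m : ℕ} (A : Multiarrangement n m)

/-- The hyperplane `Hᵢ`: the zero set of the linear form `∑ⱼ aⱼ xⱼ`, where `a` is the
`i`-th normal vector. -/
def hyperplane (i : Fin m) : Submodule ℂ (Fin n → ℂ) :=
  LinearMap.ker (∑ j, A.normal i j • (LinearMap.proj j : (Fin n → ℂ) →ₗ[ℂ] ℂ))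

/-- The rank of a subset of the hyperplanes: the dimension of the span of the normal vectors. -/
def rk (S : Finset (Fin m)) : ℕ :=
  Module.finrank ℂ (Submodule.span ℂ (A.normal '' (S : Set (Fin m))))

/-- The rank of the arrangement. -/
def rank : ℕ := A.rk Finset.univ

/-- The characteristic polynomial `∑_{S ⊆ E} (-1)^|S| X^(r - rk S)` of the matroid of the
arrangement. -/
def charPoly : Polynomial ℤ :=
  ∑ S : Finset (Fin m), (-1) ^ S.card * Polynomial.X ^ (A.rank - A.rk S)

/-- `ρ(L)`: the number of hyperplanes, with multiplicity, that do not contain `L`. -/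
def rho (L : Submodule ℂ (Fin n → ℂ)) : ℕ :=
  Set.ncard {i : Fin m | ¬ L ≤ A.hyperplane i}

end Multiarrangement

/-- The linear form `λ = ℓ₁ x₁ + ⋯ + ℓₙ xₙ`. -/
def linearForm {n : ℕ} (l : Fin n → ℂ) : MvPolynomial (Fin n) ℂ :=
  ∑ i, MvPolynomial.C (l i) * MvPolynomial.X i

namespace Multiarrangement

variable {n m : ℕ} (A : Multiarrangement n m)

/-- The power ideal `J_{A,k}`, generated by all `λ_L ^ (ρ(L) + k)` for lines `L = ℂ · ℓ`. -/
def powerIdeal (k : ℕ) : Ideal (MvPolynomial (Fin n) ℂ) :=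
  Ideal.span {f | ∃ l : Fin n → ℂ, l ≠ 0 ∧
    f = linearForm l ^ (A.rho (Submodule.span ℂ {l}) + k)}

/-- The central power ideal of the essentialization of `A`, pulled back to `ℂ[x₁, …, xₙ]`:
generated by `λ_L ^ ρ(L)` for the lines `L` not contained in all hyperplanes, and by `λ_L` for
the lines `L` contained in all of them. -/
def essCentralIdeal : Ideal (MvPolynomial (Fin n) ℂ) :=
  Ideal.span {f | ∃ l : Fin n → ℂ, l ≠ 0 ∧
    f = linearForm l ^ max (A.rho (Submodule.span ℂ {l})) 1}

end Multiarrangement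

/-- Superspace of rank `n`: `ℂ[x₁, …, xₙ] ⊗ ⋀{θ₁, …, θₙ}`. -/
abbrev Superspace (n : ℕ) : Type :=
  MvPolynomial (Fin n) ℂ ⊗[ℂ] ExteriorAlgebra ℂ (Fin n → ℂ)

namespace Superspace

variable {n : ℕ}

/-- The generator `θᵢ` of the exterior algebra. -/
def theta (i : Fin n) : ExteriorAlgebra ℂ (Fin n → ℂ) :=
  ExteriorAlgebra.ι ℂ (Pi.single i 1)

/-- The Euler operator `d f = ∑ᵢ (∂f/∂xᵢ) · θᵢ`. -/
def euler : Superspace n →ₗ[ℂ] Superspace n :=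
  ∑ i, TensorProduct.map (MvPolynomial.pderiv i).toLinearMap (LinearMap.mulRight ℂ (theta i))

/-- The bihomogeneous component of bosonic degree `i` and fermionic degree `j`. -/
def bidegree (n i j : ℕ) : Submodule ℂ (Superspace n) :=
  LinearMap.range (TensorProduct.map (MvPolynomial.homogeneousSubmodule (Fin n) ℂ i).subtype
    (⋀[ℂ]^j (Fin n → ℂ)).subtype)

/-- The differential closure of `J`: the smallest two-sided ideal of superspace that contains
`J` and is closed under `d`. -/
def differentialClosure (J : Ideal (MvPolynomial (Fin n) ℂ)) : Ideal (Superspace n) :=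
  sInf {K | K.IsTwoSided ∧ (∀ f ∈ J, f ⊗ₜ[ℂ] 1 ∈ K) ∧ ∀ w ∈ K, euler w ∈ K}

end Superspace

/-- The dimension of the image of a graded piece `V` of `R` in the quotient `R ⧸ I`. -/
def quotientPieceDim {R : Type*} [Ring R] [Algebra ℂ R] (I : Ideal R) (V : Submodule ℂ R) : ℕ :=
  Module.finrank ℂ (V.map ((Submodule.mkQ I).restrictScalars ℂ))

/-- The Hilbert series `Hilb(ℂ[x₁, …, xₙ] / J; q)` for a homogeneous ideal `J`. -/
def hilb {n : ℕ} (J : Ideal (MvPolynomial (Fin n) ℂ)) : PowerSeries ℕ :=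
  PowerSeries.mk fun i => quotientPieceDim J (MvPolynomial.homogeneousSubmodule (Fin n) ℂ i)

/-- The bigraded Hilbert series `Hilb(Ωₙ / I; q, t)` for a bihomogeneous ideal `I`; the variable
with index `0` is `q` (bosonic degree) and the variable with index `1` is `t` (fermionic
degree). -/
def bigradedHilb {n : ℕ} (I : Ideal (Superspace n)) : MvPowerSeries (Fin 2) ℕ :=
  fun e => quotientPieceDim I (Superspace.bidegree n (e 0) (e 1))

/-- The superspace ideal `I_A`: the differential closure of `J_{A,1}`. -/
def Multiarrangement.superIdeal {n m : ℕ} (A : Multiarrangement n m) : Ideal (Superspace n) :=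
  Superspace.differentialClosure (A.powerIdeal 1)

/-- The bigraded Hilbert series of `E_A = Ωₙ / I_A`. -/
def Multiarrangement.hilbE {n m : ℕ} (A : Multiarrangement n m) : MvPowerSeries (Fin 2) ℕ :=
  bigradedHilb A.superIdeal

/-- `[t^j] F`, the coefficient of `t^j` as a power series in `q`. -/
def tCoeff (j : ℕ) (F : MvPowerSeries (Fin 2) ℕ) : PowerSeries ℕ :=
  PowerSeries.mk fun i => MvPowerSeries.coeff (Finsupp.single 0 i + Finsupp.single 1 j) F

/-- The summand of maximal total degree of a polynomial. -/
def topPart (P : MvPolynomial (Fin 2) ℕ) : MvPolynomial (Fin 2) ℕ :=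
  MvPolynomial.homogeneousComponent P.totalDegree P

/-- The field `ℚ(q, t)` of rational functions, as the fraction field of `ℤ[q, t]`. -/
abbrev RatQT : Type := FractionRing (MvPolynomial (Fin 2) ℤ)

/-- The inclusion of `ℕ[q, t]` into `ℚ(q, t)`. -/
def toRatQT (P : MvPolynomial (Fin 2) ℕ) : RatQT :=
  algebraMap (MvPolynomial (Fin 2) ℤ) RatQT (MvPolynomial.map (Nat.castRingHom ℤ) P)

/-- The variable `q` in `ℚ(q, t)`. -/
def qVar : RatQT := toRatQT (MvPolynomial.X 0)

/-- The variable `t` in `ℚ(q, t)`. -/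
def tVar : RatQT := toRatQT (MvPolynomial.X 1)

end

/-!
The ideal `I_A` has a dual description: an element of superspace lies in it if and only if it is
killed by every functional that applies, for each normal vector of `A`, the derivative or the
interior product along it or nothing, and then sets all variables to zero. The elements
`λ ^ (ρ + 1)` and `λ ^ ρ dλ` of `I_A` and their multiples satisfy this by the Leibniz rule. That
conversely every solution is a combination of such multiples is proved by induction on the
arrangement: the derivative along a normal vector `b` maps the multiples for `A` onto those for the
deletion of `b`, by integration by parts along `λ`, and the solutions killed by this derivative
belong to the contraction by `b`. The same exact sequence makes the Hilbert series obey a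
deletion-contraction recursion.

Without fermions only the powers `λ ^ (ρ + 1)` contribute, which is the external algebra. In
fermionic degree `r` all forms `ω` of bidegree `(0, r)` are proportional modulo `I_A`, and
`λ ^ ρ ω` lies in `I_A` because `ω dλ` and its interior products along normal vectors do: this is
the central algebra. In top total degree the recursion unrolls into the signed subset sum of the
characteristic polynomial.
-/

noncomputable section

section ExteriorAlgebra

open CliffordAlgebra

variable {R M N : Type*} [CommRing R] [AddCommGroup M] [Module R M] [AddCommGroup N] [Module R N]

lemma contractRight_mul {Q : QuadraticForm R M} (d : Module.Dual R M) (a b : CliffordAlgebra Q) :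
    contractRight (a * b) d = a * contractRight b d + contractRight a d * involute b := by
  induction b using CliffordAlgebra.right_induction with
  | algebraMap r =>
    rw [contractRight_mul_algebraMap, contractRight_algebraMap, AlgHom.commutes, mul_zero, zero_add]
  | add x y hx hy => simp only [mul_add, map_add, LinearMap.add_apply, hx, hy]; abel
  | mul_ι m x hx =>
    rw [← mul_assoc, contractRight_mul_ι, hx, contractRight_mul_ι, map_mul, involute_ι]
    simp only [mul_sub, add_mul, mul_neg, mul_smul_comm, mul_assoc]
    abel

lemma involute_contractRight {Q : QuadraticForm R M} (d : Module.Dual R M)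
    (a : CliffordAlgebra Q) : involute (contractRight a d) = -contractRight (involute a) d := by
  induction a using CliffordAlgebra.right_induction with
  | algebraMap r => simp only [contractRight_algebraMap, AlgHom.commutes, map_zero, neg_zero]
  | add x y hx hy => simp only [map_add, LinearMap.add_apply, hx, hy, neg_add]
  | mul_ι m x hx =>
    simp only [contractRight_mul_ι, map_sub, map_smul, map_mul (involute (Q := Q)), involute_ι, hx,
      mul_neg, map_neg, LinearMap.neg_apply]
    simp

lemma map_involute (f : M →ₗ[R] N) (a : ExteriorAlgebra R M) :
    ExteriorAlgebra.map f (involute a) = involute (ExteriorAlgebra.map f a) := by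
  induction a using CliffordAlgebra.right_induction with
  | algebraMap r => simp only [AlgHom.commutes]
  | add x y hx hy => simp only [map_add, hx, hy]
  | mul_ι m x hx =>
    have h := ExteriorAlgebra.map_apply_ι f m
    rw [map_mul, map_mul, map_mul, map_mul, involute_ι, map_neg, hx, h, involute_ι]

lemma map_contractRight (f : M →ₗ[R] N) (d : Module.Dual R N) (a : ExteriorAlgebra R M) :
    ExteriorAlgebra.map f (contractRight a (d ∘ₗ f)) =
      contractRight (ExteriorAlgebra.map f a) d := by
  induction a using CliffordAlgebra.right_induction with
  | algebraMap r => simp only [contractRight_algebraMap, AlgHom.commutes, map_zero]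
  | add x y hx hy => simp only [map_add, LinearMap.add_apply, hx, hy]
  | mul_ι m x hx =>
    have h := ExteriorAlgebra.map_apply_ι f m
    rw [contractRight_mul_ι, map_sub, map_mul, map_mul, hx, h, contractRight_mul_ι, map_smul,
      LinearMap.comp_apply]

lemma exteriorPower_succ (j : ℕ) :
    ⋀[R]^(j + 1) M = ⋀[R]^j M * LinearMap.range (ExteriorAlgebra.ι R) :=
  pow_succ _ j

lemma exteriorPower_zero : ⋀[R]^0 M = 1 :=
  pow_zero _

lemma mul_ι_mem_exteriorPower {j : ℕ} {a : ExteriorAlgebra R M} (ha : a ∈ ⋀[R]^j M) (m : M) :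
    a * ExteriorAlgebra.ι R m ∈ ⋀[R]^(j + 1) M :=
  exteriorPower_succ (R := R) (M := M) j ▸ Submodule.mul_mem_mul ha ⟨m, rfl⟩

lemma mul_ι_mem_exteriorPower_mul_map_ι {j : ℕ} {K : Submodule R M} {a : ExteriorAlgebra R M}
    (ha : a ∈ ⋀[R]^j M * K.map (ExteriorAlgebra.ι R)) (m : M) :
    a * ExteriorAlgebra.ι R m ∈ ⋀[R]^(j + 1) M * K.map (ExteriorAlgebra.ι R) := by
  induction ha using Submodule.mul_induction_on' with
  | add x _ y _ hx hy => rw [add_mul]; exact add_mem hx hy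
  | mem_mul_mem x hx y hy =>
    obtain ⟨v, hv, rfl⟩ := hy
    rw [mul_assoc, eq_neg_of_add_eq_zero_left (ExteriorAlgebra.ι_add_mul_swap v m), mul_neg,
      ← mul_assoc]
    exact neg_mem (Submodule.mul_mem_mul (mul_ι_mem_exteriorPower hx m) ⟨v, hv, rfl⟩)

lemma sub_map_mem_exteriorPower_mul_map_ι_ker {f : M →ₗ[R] N} {s : N →ₗ[R] M}
    (hs : f ∘ₗ s = LinearMap.id) {j : ℕ} {a : ExteriorAlgebra R M} (ha : a ∈ ⋀[R]^(j + 1) M) :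
    a - ExteriorAlgebra.map (s ∘ₗ f) a ∈
      ⋀[R]^j M * (LinearMap.ker f).map (ExteriorAlgebra.ι R) := by
  have hker (m : M) : m - s (f m) ∈ LinearMap.ker f := by
    rw [LinearMap.mem_ker, map_sub, sub_eq_zero]
    exact (LinearMap.congr_fun hs (f m)).symm
  rw [exteriorPower_succ] at ha
  induction ha using Submodule.mul_induction_on' with
  | add x _ y _ hx hy => rw [map_add, add_sub_add_comm]; exact add_mem hx hy
  | mem_mul_mem x hx _ hm =>
    obtain ⟨m, rfl⟩ := hm
    have h := ExteriorAlgebra.map_apply_ι (s ∘ₗ f) m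
    have hsplit : ∀ b : ExteriorAlgebra R M,
        x * ExteriorAlgebra.ι R m - b * ExteriorAlgebra.ι R (s (f m)) =
          x * ExteriorAlgebra.ι R (m - s (f m)) + (x - b) * ExteriorAlgebra.ι R (s (f m)) :=
      fun b => by rw [map_sub, mul_sub, sub_mul]; abel
    rw [map_mul, h, LinearMap.comp_apply, hsplit]
    refine add_mem (Submodule.mul_mem_mul hx (Submodule.mem_map_of_mem (hker m))) ?_
    cases j with
    | zero =>
      rw [exteriorPower_zero, Submodule.mem_one] at hx
      obtain ⟨c, rfl⟩ := hx
      rw [AlgHom.commutes, sub_self, zero_mul]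
      exact zero_mem _
    | succ j =>
      exact mul_ι_mem_exteriorPower_mul_map_ι (sub_map_mem_exteriorPower_mul_map_ι_ker hs hx) _

lemma sub_map_mem_span_ι_ker {f : M →ₗ[R] N} {s : N →ₗ[R] M} (hs : f ∘ₗ s = LinearMap.id)
    (a : ExteriorAlgebra R M) :
    a - ExteriorAlgebra.map (s ∘ₗ f) a ∈
      Ideal.span (ExteriorAlgebra.ι R '' (LinearMap.ker f : Set M)) := by
  induction a using DirectSum.Decomposition.inductionOn (fun j => ⋀[R]^j M) with
  | zero => rw [map_zero, sub_zero]; exact zero_mem _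
  | add x y hx hy => rw [map_add, add_sub_add_comm]; exact add_mem hx hy
  | @homogeneous j x =>
    obtain ⟨x, hx⟩ := x
    cases j with
    | zero =>
      rw [exteriorPower_zero, Submodule.mem_one] at hx
      obtain ⟨c, rfl⟩ := hx
      rw [AlgHom.commutes, sub_self]
      exact zero_mem _
    | succ j =>
      refine (Submodule.mul_le (P := (Ideal.span (ExteriorAlgebra.ι R ''
        (LinearMap.ker f : Set M))).restrictScalars R)).2 ?_
        (sub_map_mem_exteriorPower_mul_map_ι_ker hs hx)
      rintro y - _ ⟨m, hm, rfl⟩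
      exact Ideal.mul_mem_left _ y (Ideal.subset_span ⟨m, hm, rfl⟩)

lemma mem_exteriorPower_mul_map_ι_ker_of_map_eq_zero {f : M →ₗ[R] N} {s : N →ₗ[R] M}
    (hs : f ∘ₗ s = LinearMap.id) {j : ℕ} {a : ExteriorAlgebra R M} (ha : a ∈ ⋀[R]^(j + 1) M)
    (hfa : ExteriorAlgebra.map f a = 0) :
    a ∈ ⋀[R]^j M * (LinearMap.ker f).map (ExteriorAlgebra.ι R) := by
  have h := sub_map_mem_exteriorPower_mul_map_ι_ker hs ha
  rwa [← ExteriorAlgebra.map_comp_map, AlgHom.comp_apply, hfa, map_zero, sub_zero] at h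

lemma mem_span_ι_ker_of_map_eq_zero {f : M →ₗ[R] N} {s : N →ₗ[R] M}
    (hs : f ∘ₗ s = LinearMap.id) {a : ExteriorAlgebra R M} (ha : ExteriorAlgebra.map f a = 0) :
    a ∈ Ideal.span (ExteriorAlgebra.ι R '' (LinearMap.ker f : Set M)) := by
  have h := sub_map_mem_span_ι_ker hs a
  rwa [← ExteriorAlgebra.map_comp_map, AlgHom.comp_apply, ha, map_zero, sub_zero] at h

lemma eq_zero_of_map_eq_zero_of_map_contractRight_eq_zero {f : M →ₗ[R] N} {s : N →ₗ[R] M}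
    (hs : f ∘ₗ s = LinearMap.id) {v : M} (hv : LinearMap.ker f = Submodule.span R {v})
    {d : Module.Dual R M} (hd : d v = 1) {a : ExteriorAlgebra R M}
    (ha : ExteriorAlgebra.map f a = 0) (had : ExteriorAlgebra.map f (contractRight a d) = 0) :
    a = 0 := by
  have hfactor : ∀ x : ExteriorAlgebra R M, ExteriorAlgebra.map f x = 0 →
      ∃ y, y * ExteriorAlgebra.ι R v = x := by
    intro x hx
    have hle : Ideal.span (ExteriorAlgebra.ι R '' (LinearMap.ker f : Set M)) ≤
        Ideal.span {ExteriorAlgebra.ι R v} := by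
      rw [hv, Ideal.span_le]
      rintro _ ⟨_, hu, rfl⟩
      obtain ⟨c, rfl⟩ := Submodule.mem_span_singleton.1 hu
      rw [map_smul, Algebra.smul_def]
      exact Ideal.mul_mem_left _ _ (Ideal.mem_span_singleton_self _)
    exact Submodule.mem_span_singleton.1 (hle (mem_span_ι_ker_of_map_eq_zero hs hx))
  have hmapv := ExteriorAlgebra.map_apply_ι f v
  have hfv : f v = 0 := LinearMap.mem_ker.1 (hv ▸ Submodule.mem_span_singleton_self v)
  obtain ⟨y, rfl⟩ := hfactor a ha
  rw [contractRight_mul_ι, hd, one_smul, map_sub, map_mul, hmapv, hfv, map_zero, mul_zero,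
    sub_zero] at had
  obtain ⟨z, rfl⟩ := hfactor y had
  rw [mul_assoc, ExteriorAlgebra.ι_sq_zero, mul_zero]

end ExteriorAlgebra

lemma rTensor_derivation_mul {R A B : Type*} [CommRing R] [CommRing A] [Algebra R A] [Ring B]
    [Algebra R B] (D : Derivation R A A) (x y : A ⊗[R] B) :
    LinearMap.rTensor B D.toLinearMap (x * y) =
      LinearMap.rTensor B D.toLinearMap x * y + x * LinearMap.rTensor B D.toLinearMap y := by
  induction x with
  | zero => simp only [zero_mul, map_zero, add_zero]
  | add x₁ x₂ h₁ h₂ => simp only [add_mul, map_add, h₁, h₂]; abel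
  | tmul a b =>
    induction y with
    | zero => simp only [mul_zero, map_zero, add_zero]
    | add y₁ y₂ h₁ h₂ => simp only [mul_add, map_add, h₁, h₂]; abel
    | tmul c d =>
      simp only [Algebra.TensorProduct.tmul_mul_tmul, LinearMap.rTensor_tmul,
        Derivation.coeFn_coe, Derivation.leibniz, smul_eq_mul,
        ← TensorProduct.add_tmul]
      rw [add_comm, mul_comm c]

lemma pderiv_comm {σ R : Type*} [CommRing R] (i j : σ) (p : MvPolynomial σ R) :
    MvPolynomial.pderiv i (MvPolynomial.pderiv j p) =
      MvPolynomial.pderiv j (MvPolynomial.pderiv i p) := by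
  classical
  have h : ⁅MvPolynomial.pderiv (R := R) i, MvPolynomial.pderiv j⁆ = 0 :=
    MvPolynomial.derivation_ext fun k => by
      rw [Derivation.commutator_apply, MvPolynomial.pderiv_X, MvPolynomial.pderiv_X]
      simp [Pi.single_apply, apply_ite]
  simpa [Derivation.commutator_apply, sub_eq_zero] using congrArg (· p) h

namespace Superspace

open MvPolynomial

variable {n : ℕ}

/-- The directional derivative `∑ᵢ wᵢ ∂/∂xᵢ` of superspace, linear in the direction `w`. -/
def deriv : (Fin n → ℂ) →ₗ[ℂ] Module.End ℂ (Superspace n) :=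
  Fintype.linearCombination ℂ fun i => LinearMap.rTensor _ (pderiv i).toLinearMap

/-- The interior product with the direction `w`, acting from the right: it is the right
antiderivation with `θᵢ ↦ wᵢ`. -/
def contr : (Fin n → ℂ) →ₗ[ℂ] Module.End ℂ (Superspace n) :=
  LinearMap.lTensorHom _ ∘ₗ CliffordAlgebra.contractRight.flip ∘ₗ
    (dotProductEquiv ℂ (Fin n)).toLinearMap

/-- The parity involution `θᵢ ↦ -θᵢ` of superspace. -/
def parity : Superspace n →ₐ[ℂ] Superspace n :=
  Algebra.TensorProduct.map (AlgHom.id ℂ _) CliffordAlgebra.involute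

/-- The linear form `∑ᵢ vᵢ xᵢ` as an element of superspace. -/
def lin (v : Fin n → ℂ) : Superspace n := linearForm v ⊗ₜ 1

/-- The one-form `∑ᵢ vᵢ θᵢ`, the image of `lin v` under the Euler operator. -/
def form : (Fin n → ℂ) →ₗ[ℂ] Superspace n :=
  TensorProduct.mk ℂ _ _ 1 ∘ₗ ExteriorAlgebra.ι ℂ

lemma deriv_tmul (w : Fin n → ℂ) (p : MvPolynomial (Fin n) ℂ)
    (ω : ExteriorAlgebra ℂ (Fin n → ℂ)) :
    deriv w (p ⊗ₜ ω) = (∑ i, w i • pderiv i p) ⊗ₜ ω := by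
  simp [deriv, Fintype.linearCombination_apply, TensorProduct.sum_tmul, TensorProduct.smul_tmul']

@[simp] lemma contr_tmul (w : Fin n → ℂ) (p : MvPolynomial (Fin n) ℂ)
    (ω : ExteriorAlgebra ℂ (Fin n → ℂ)) : contr w (p ⊗ₜ ω) =
      p ⊗ₜ CliffordAlgebra.contractRight ω (dotProductEquiv ℂ (Fin n) w) :=
  rfl

@[simp] lemma parity_tmul (p : MvPolynomial (Fin n) ℂ) (ω : ExteriorAlgebra ℂ (Fin n → ℂ)) :
    parity (p ⊗ₜ ω) = p ⊗ₜ CliffordAlgebra.involute ω :=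
  rfl

lemma form_apply (v : Fin n → ℂ) : form v = 1 ⊗ₜ ExteriorAlgebra.ι ℂ v :=
  rfl

lemma lin_pow (v : Fin n → ℂ) (k : ℕ) : lin v ^ k = (linearForm v ^ k) ⊗ₜ 1 := by
  simp [lin, Algebra.TensorProduct.tmul_pow]

lemma tmul_one_commute (p : MvPolynomial (Fin n) ℂ) (a : Superspace n) :
    Commute (p ⊗ₜ 1) a := by
  induction a using TensorProduct.induction_on with
  | zero => exact Commute.zero_right _
  | add x y hx hy => exact hx.add_right hy
  | tmul q ω => simp [Commute, SemiconjBy, mul_comm]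

lemma lin_pow_commute (v : Fin n → ℂ) (k : ℕ) (a : Superspace n) : Commute (lin v ^ k) a :=
  lin_pow v k ▸ tmul_one_commute _ a

lemma deriv_mul (w : Fin n → ℂ) (a b : Superspace n) :
    deriv w (a * b) = deriv w a * b + a * deriv w b := by
  simp only [deriv, Fintype.linearCombination_apply, LinearMap.sum_apply, LinearMap.smul_apply,
    rTensor_derivation_mul, Finset.sum_mul, Finset.mul_sum, smul_add, Finset.sum_add_distrib,
    smul_mul_assoc, mul_smul_comm]

lemma contr_mul (w : Fin n → ℂ) (a b : Superspace n) :
    contr w (a * b) = a * contr w b + contr w a * parity b := by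
  induction a using TensorProduct.induction_on with
  | zero => simp only [zero_mul, map_zero, add_zero]
  | add x y hx hy => simp only [add_mul, map_add, hx, hy]; abel
  | tmul p ω =>
    induction b using TensorProduct.induction_on with
    | zero => simp only [mul_zero, map_zero, add_zero]
    | add x y hx hy => simp only [mul_add, map_add, hx, hy]; abel
    | tmul q η => simp [contractRight_mul, TensorProduct.tmul_add]

lemma deriv_comm (w v : Fin n → ℂ) (a : Superspace n) :
    deriv w (deriv v a) = deriv v (deriv w a) := by
  induction a using TensorProduct.induction_on with
  | zero => simp only [map_zero]
  | add x y hx hy => simp only [map_add, hx, hy]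
  | tmul p ω =>
    simp only [deriv_tmul, map_sum, Derivation.map_smul, Finset.smul_sum]
    rw [Finset.sum_comm]
    simp only [pderiv_comm, smul_comm (w _) (v _)]

lemma contr_deriv (w v : Fin n → ℂ) (a : Superspace n) :
    contr w (deriv v a) = deriv v (contr w a) := by
  induction a using TensorProduct.induction_on with
  | zero => simp only [map_zero]
  | add x y hx hy => simp only [map_add, hx, hy]
  | tmul p ω => simp only [deriv_tmul, contr_tmul]

lemma parity_deriv (w : Fin n → ℂ) (a : Superspace n) :
    parity (deriv w a) = deriv w (parity a) := by
  induction a using TensorProduct.induction_on with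
  | zero => simp only [map_zero]
  | add x y hx hy => simp only [map_add, hx, hy]
  | tmul p ω => simp only [deriv_tmul, parity_tmul]

lemma contr_contr (w v : Fin n → ℂ) (a : Superspace n) :
    contr w (contr v a) = -contr v (contr w a) := by
  induction a using TensorProduct.induction_on with
  | zero => simp only [map_zero, neg_zero]
  | add x y hx hy => simp only [map_add, hx, hy, neg_add]
  | tmul p ω =>
    rw [contr_tmul, contr_tmul, contr_tmul, contr_tmul, CliffordAlgebra.contractRight_comm,
      TensorProduct.tmul_neg]

lemma parity_contr (w : Fin n → ℂ) (a : Superspace n) :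
    parity (contr w a) = -contr w (parity a) := by
  induction a using TensorProduct.induction_on with
  | zero => simp only [map_zero, neg_zero]
  | add x y hx hy => simp only [map_add, hx, hy, neg_add]
  | tmul p ω =>
    rw [contr_tmul, parity_tmul, parity_tmul, contr_tmul, involute_contractRight,
      TensorProduct.tmul_neg]

@[simp] lemma deriv_form (w v : Fin n → ℂ) : deriv w (form v) = 0 := by
  simp [form_apply, deriv_tmul]

lemma deriv_lin (w v : Fin n → ℂ) : deriv w (lin v) = (w ⬝ᵥ v) • 1 := by
  have h (i : Fin n) : pderiv i (linearForm v) = C (v i) := by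
    simp [linearForm, Pi.single_apply]
  simp [lin, deriv_tmul, h, dotProduct, Algebra.TensorProduct.one_def, TensorProduct.smul_tmul',
    MvPolynomial.smul_eq_C_mul]

lemma deriv_lin_pow (w v : Fin n → ℂ) (k : ℕ) :
    deriv w (lin v ^ (k + 1)) = ((k + 1 : ℂ) * (w ⬝ᵥ v)) • lin v ^ k := by
  induction k with
  | zero => simp [deriv_lin]
  | succ k ih =>
    rw [pow_succ, deriv_mul, ih, deriv_lin, smul_mul_assoc, ← pow_succ, mul_smul_comm, mul_one,
      ← add_smul]
    push_cast
    ring_nf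

lemma deriv_lin_pow_eq_zero {w v : Fin n → ℂ} (h : w ⬝ᵥ v = 0) (k : ℕ) :
    deriv w (lin v ^ k) = 0 := by
  cases k with
  | zero => simp [Algebra.TensorProduct.one_def, deriv_tmul]
  | succ k => rw [deriv_lin_pow, h, mul_zero, zero_smul]

lemma contr_mul_form (w v : Fin n → ℂ) (a : Superspace n) :
    contr w (a * form v) = (w ⬝ᵥ v) • a - contr w a * form v := by
  have hparity : parity (form v) + form v = 0 := by
    rw [form_apply, parity_tmul, CliffordAlgebra.involute_ι, ← TensorProduct.tmul_add]
    exact (congrArg _ (neg_add_cancel _)).trans (TensorProduct.tmul_zero _ _)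
  have hcontr : contr w (form v) = (w ⬝ᵥ v) • 1 := by
    rw [form_apply, contr_tmul, CliffordAlgebra.contractRight_ι]
    simp [Algebra.algebraMap_eq_smul_one, Algebra.TensorProduct.one_def]
  refine eq_sub_of_add_eq ?_
  rw [contr_mul, add_assoc, ← mul_add, hparity, mul_zero, add_zero, hcontr, mul_smul_comm, mul_one]

lemma contr_lin_pow (w v : Fin n → ℂ) (k : ℕ) : contr w (lin v ^ k) = 0 := by
  rw [lin_pow, contr_tmul, CliffordAlgebra.contractRight_one, TensorProduct.tmul_zero]

lemma euler_apply (a : Superspace n) :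
    euler a = ∑ i, deriv (Pi.single i 1) a * form (Pi.single i 1) := by
  rw [euler, LinearMap.sum_apply]
  refine Finset.sum_congr rfl fun i _ => ?_
  induction a using TensorProduct.induction_on with
  | zero => simp only [map_zero, zero_mul]
  | add x y hx hy => simp only [map_add, add_mul, hx, hy]
  | tmul p ω => simp [form_apply, theta, deriv_tmul, Pi.single_apply]

lemma deriv_euler (w : Fin n → ℂ) (a : Superspace n) :
    deriv w (euler a) = euler (deriv w a) := by
  simp [euler_apply, deriv_mul, deriv_comm w]

lemma contr_euler (w : Fin n → ℂ) (a : Superspace n) :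
    contr w (euler a) = deriv w a - euler (contr w a) := by
  have h : deriv w a = ∑ i, w i • deriv (Pi.single i 1) a := by
    conv_lhs => rw [pi_eq_sum_univ' w, map_sum, LinearMap.sum_apply]
    simp only [map_smul, LinearMap.smul_apply]
  simp [euler_apply, contr_mul_form, contr_deriv, Finset.sum_sub_distrib, h]

lemma euler_lin_pow (v : Fin n → ℂ) (k : ℕ) :
    euler (lin v ^ (k + 1)) = (k + 1 : ℂ) • (lin v ^ k * form v) := by
  have h : form v = ∑ i, v i • form (Pi.single i 1) := by
    conv_lhs => rw [pi_eq_sum_univ' v, map_sum]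
    simp only [map_smul]
  simp only [euler_apply, deriv_lin_pow, h, Finset.mul_sum, Finset.smul_sum, smul_mul_assoc,
    mul_smul_comm, smul_smul, single_one_dotProduct]

end Superspace

lemma isHomogeneous_linearForm {n : ℕ} (v : Fin n → ℂ) : (linearForm v).IsHomogeneous 1 :=
  MvPolynomial.IsHomogeneous.sum _ _ _ fun i _ => by
    simpa using (MvPolynomial.isHomogeneous_C (Fin n) (v i)).mul (MvPolynomial.isHomogeneous_X ℂ i)

namespace Superspace

open MvPolynomial

variable {n : ℕ}

lemma bidegree_le_iff {i j : ℕ} {K : Submodule ℂ (Superspace n)} :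
    bidegree n i j ≤ K ↔ ∀ (p : MvPolynomial (Fin n) ℂ) (ω : ExteriorAlgebra ℂ (Fin n → ℂ)),
      p.IsHomogeneous i → ω ∈ ⋀[ℂ]^j (Fin n → ℂ) → p ⊗ₜ ω ∈ K := by
  rw [bidegree, TensorProduct.range_map_eq_span_tmul, Submodule.span_le]
  constructor
  · exact fun h p ω hp hω => h ⟨⟨p, hp⟩, ⟨ω, hω⟩, rfl⟩
  · rintro h _ ⟨p, ω, rfl⟩
    exact h p ω p.2 ω.2

lemma tmul_mem_bidegree {i j : ℕ} {p : MvPolynomial (Fin n) ℂ}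
    {ω : ExteriorAlgebra ℂ (Fin n → ℂ)} (hp : p.IsHomogeneous i)
    (hω : ω ∈ ⋀[ℂ]^j (Fin n → ℂ)) : p ⊗ₜ ω ∈ bidegree n i j :=
  bidegree_le_iff.1 le_rfl p ω hp hω

lemma mul_lin_pow_mem_bidegree {i j : ℕ} (v : Fin n → ℂ) (k : ℕ) {a : Superspace n}
    (ha : a ∈ bidegree n i j) : a * lin v ^ k ∈ bidegree n (i + k) j := by
  have h : bidegree n i j ≤
      (bidegree n (i + k) j).comap (LinearMap.mulRight ℂ (lin v ^ k)) :=
    bidegree_le_iff.2 fun p ω hp hω => by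
      have hk : (linearForm v ^ k).IsHomogeneous k := by
        simpa using (isHomogeneous_linearForm v).pow k
      simpa [lin_pow] using tmul_mem_bidegree (hp.mul hk) hω
  exact h ha

lemma mul_form_mem_bidegree {i j : ℕ} (v : Fin n → ℂ) {a : Superspace n}
    (ha : a ∈ bidegree n i j) : a * form v ∈ bidegree n i (j + 1) := by
  have h : bidegree n i j ≤ (bidegree n i (j + 1)).comap (LinearMap.mulRight ℂ (form v)) :=
    bidegree_le_iff.2 fun p ω hp hω => by
      simpa [form_apply] using tmul_mem_bidegree hp (mul_ι_mem_exteriorPower hω v)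
  exact h ha

lemma deriv_mem_bidegree {i j : ℕ} (w : Fin n → ℂ) {a : Superspace n}
    (ha : a ∈ bidegree n (i + 1) j) : deriv w a ∈ bidegree n i j := by
  have h : bidegree n (i + 1) j ≤ (bidegree n i j).comap (deriv w) :=
    bidegree_le_iff.2 fun p ω hp hω => by
      rw [Submodule.mem_comap, deriv_tmul]
      exact tmul_mem_bidegree (IsHomogeneous.sum _ _ _ fun k _ =>
        (homogeneousSubmodule (Fin n) ℂ i).smul_mem _ hp.pderiv) hω
  exact h ha

lemma deriv_eq_zero_of_mem_bidegree {j : ℕ} (w : Fin n → ℂ) {a : Superspace n}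
    (ha : a ∈ bidegree n 0 j) : deriv w a = 0 := by
  have h : bidegree n 0 j ≤ LinearMap.ker (deriv w) := bidegree_le_iff.2 fun p ω hp _ => by
    have hC := totalDegree_eq_zero_iff_eq_C.1 (Nat.le_zero.1 hp.totalDegree_le)
    rw [LinearMap.mem_ker, hC, deriv_tmul]
    simp
  exact h ha

lemma sum_deriv_mul_lin {i j : ℕ} {a : Superspace n} (ha : a ∈ bidegree n i j) :
    ∑ k, deriv (Pi.single k 1) a * lin (Pi.single k 1) = (i : ℂ) • a := by
  have h : bidegree n i j ≤ LinearMap.eqLocus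
      (∑ k : Fin n, LinearMap.mulRight ℂ (lin (Pi.single k 1)) ∘ₗ deriv (Pi.single k 1))
      ((i : ℂ) • LinearMap.id) :=
    bidegree_le_iff.2 fun p ω hp _ => by
      have hsum : ∑ k, pderiv k p * X k = (i : ℂ) • p := by
        simpa [mul_comm, Algebra.smul_def] using hp.sum_X_mul_pderiv
      simp [lin, linearForm, deriv_tmul, Pi.single_apply, ← TensorProduct.sum_tmul, hsum,
        TensorProduct.smul_tmul']
  simpa using h ha

instance (i j : ℕ) : FiniteDimensional ℂ (bidegree n i j) := by
  have : FiniteDimensional ℂ (homogeneousSubmodule (Fin n) ℂ i) :=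
    Module.Finite.iff_fg.2 (homogeneousSubmodule_fg _ _ i)
  unfold bidegree
  infer_instance

end Superspace

/-! ### The inverse system of the superspace ideal -/

namespace Superspace

open MvPolynomial

variable {n : ℕ}

/-- The linear form with coefficient vector `v`, restricted to the subspace `W`. -/
def restrictForm (W : Submodule ℂ (Fin n → ℂ)) : (Fin n → ℂ) →ₗ[ℂ] Module.Dual ℂ W :=
  W.dualRestrict ∘ₗ (dotProductEquiv ℂ (Fin n)).toLinearMap

/-- Restriction of the fermions to `W`: the polynomial variables are sent to `0`, and the one-form
with coefficient vector `v` is sent to the linear form of `v` on `W`. -/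
def restrict (W : Submodule ℂ (Fin n → ℂ)) :
    Superspace n →ₐ[ℂ] ExteriorAlgebra ℂ (Module.Dual ℂ W) :=
  (Algebra.TensorProduct.lid ℂ _).toAlgHom.comp
    (Algebra.TensorProduct.map (aeval 0) (ExteriorAlgebra.map (restrictForm W)))

lemma restrictForm_apply {W : Submodule ℂ (Fin n → ℂ)} (v : Fin n → ℂ) (w : W) :
    restrictForm W v w = w ⬝ᵥ v :=
  dotProduct_comm v (w : Fin n → ℂ)

lemma restrictForm_surjective (W : Submodule ℂ (Fin n → ℂ)) :
    Function.Surjective (restrictForm W) :=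
  (Subspace.dualRestrict_surjective (W := W)).comp (dotProductEquiv ℂ (Fin n)).surjective

lemma mem_ker_restrictForm {W : Submodule ℂ (Fin n → ℂ)} {v : Fin n → ℂ} :
    v ∈ LinearMap.ker (restrictForm W) ↔ ∀ w ∈ W, w ⬝ᵥ v = 0 := by
  simp [LinearMap.ext_iff, restrictForm_apply]

lemma restrict_tmul (W : Submodule ℂ (Fin n → ℂ)) (p : MvPolynomial (Fin n) ℂ)
    (ω : ExteriorAlgebra ℂ (Fin n → ℂ)) : restrict W (p ⊗ₜ ω) =
      (aeval (0 : Fin n → ℂ) p : ℂ) • ExteriorAlgebra.map (restrictForm W) ω :=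
  rfl

lemma restrict_form (W : Submodule ℂ (Fin n → ℂ)) (v : Fin n → ℂ) :
    restrict W (form v) = ExteriorAlgebra.ι ℂ (restrictForm W v) := by
  rw [form_apply, restrict_tmul, map_one, one_smul]
  exact ExteriorAlgebra.map_apply_ι _ _

lemma restrict_lin (W : Submodule ℂ (Fin n → ℂ)) (v : Fin n → ℂ) : restrict W (lin v) = 0 := by
  rw [lin, restrict_tmul]
  simp [linearForm]

lemma restrict_contr {W : Submodule ℂ (Fin n → ℂ)} (w : W) (a : Superspace n) :
    restrict W (contr w a) =
      CliffordAlgebra.contractRight (restrict W a) (Module.Dual.eval ℂ W w) := by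
  have hw : dotProductEquiv ℂ (Fin n) w = Module.Dual.eval ℂ W w ∘ₗ restrictForm W :=
    LinearMap.ext fun v => (restrictForm_apply v w).symm
  induction a using TensorProduct.induction_on with
  | zero => simp only [map_zero, LinearMap.zero_apply]
  | add x y hx hy => simp only [map_add, LinearMap.add_apply, hx, hy]
  | tmul p ω =>
    rw [contr_tmul, restrict_tmul, restrict_tmul, hw, map_contractRight, map_smul,
      LinearMap.smul_apply]

lemma restrict_parity (W : Submodule ℂ (Fin n → ℂ)) (a : Superspace n) :
    restrict W (parity a) = CliffordAlgebra.involute (restrict W a) := by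
  induction a using TensorProduct.induction_on with
  | zero => simp only [map_zero]
  | add x y hx hy => simp only [map_add, hx, hy]
  | tmul p ω => rw [parity_tmul, restrict_tmul, restrict_tmul, map_smul, map_involute]

lemma map_restrict {V W : Submodule ℂ (Fin n → ℂ)} (h : W ≤ V) (a : Superspace n) :
    ExteriorAlgebra.map (Submodule.inclusion h).dualMap (restrict V a) = restrict W a := by
  induction a using TensorProduct.induction_on with
  | zero => simp only [map_zero]
  | add x y hx hy => simp only [map_add, hx, hy]
  | tmul p ω =>
    rw [restrict_tmul, restrict_tmul, map_smul, ← AlgHom.comp_apply, ExteriorAlgebra.map_comp_map]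
    rfl

lemma exists_dual_sup_span_singleton {W : Submodule ℂ (Fin n → ℂ)} {b : Fin n → ℂ} (hb : b ∉ W) :
    ∃ v : Module.Dual ℂ ↥(W ⊔ Submodule.span ℂ {b}),
      v ⟨b, Submodule.mem_sup_right (Submodule.mem_span_singleton_self b)⟩ = 1 ∧
      LinearMap.ker (Submodule.inclusion (le_sup_left : W ≤ W ⊔ Submodule.span ℂ {b})).dualMap =
        Submodule.span ℂ {v} := by
  obtain ⟨φ, hφb, hφW⟩ := Submodule.exists_dual_map_eq_bot_of_notMem hb inferInstance
  have hφ : ∀ w ∈ W, φ w = 0 := fun w hw =>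
    (Submodule.mem_bot ℂ).1 (hφW ▸ Submodule.mem_map_of_mem hw)
  refine ⟨(φ b)⁻¹ • φ.domRestrict _, inv_mul_cancel₀ hφb, le_antisymm (fun ψ hψ => ?_) ?_⟩
  · refine Submodule.mem_span_singleton.2 ⟨ψ ⟨b, Submodule.mem_sup_right
      (Submodule.mem_span_singleton_self b)⟩, LinearMap.ext fun ⟨x, hx⟩ => ?_⟩
    obtain ⟨w, hw, _, hc, rfl⟩ := Submodule.mem_sup.1 hx
    obtain ⟨c, rfl⟩ := Submodule.mem_span_singleton.1 hc
    have hψw : ψ ⟨w, Submodule.mem_sup_left hw⟩ = 0 := LinearMap.congr_fun hψ ⟨w, hw⟩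
    have hsplit : (⟨w + c • b, hx⟩ : ↥(W ⊔ Submodule.span ℂ {b})) =
        ⟨w, Submodule.mem_sup_left hw⟩ +
          c • ⟨b, Submodule.mem_sup_right (Submodule.mem_span_singleton_self b)⟩ := rfl
    rw [hsplit, map_add, map_add, hψw, map_smul, map_smul]
    simp [hφ w hw, hφb, mul_comm]
  · rw [Submodule.span_singleton_le_iff_mem, LinearMap.mem_ker]
    ext w
    simp [hφ w w.2]

lemma restrict_sup_eq_zero_iff {W : Submodule ℂ (Fin n → ℂ)} {b : Fin n → ℂ} (hb : b ∉ W)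
    {a : Superspace n} : restrict (W ⊔ Submodule.span ℂ {b}) a = 0 ↔
      restrict W a = 0 ∧ restrict W (contr b a) = 0 := by
  set V := W ⊔ Submodule.span ℂ {b}
  have hWV : W ≤ V := le_sup_left
  have hbV : b ∈ V := Submodule.mem_sup_right (Submodule.mem_span_singleton_self b)
  have hcontr := restrict_contr (⟨b, hbV⟩ : V) a
  rw [← map_restrict hWV a, ← map_restrict hWV (contr b a), hcontr]
  refine ⟨fun h => by simp only [h, map_zero, LinearMap.zero_apply, and_self], fun h => ?_⟩
  obtain ⟨v, hvb, hker⟩ := exists_dual_sup_span_singleton hb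
  obtain ⟨s, hs⟩ := (Submodule.inclusion hWV).dualMap.exists_rightInverse_of_surjective
    (LinearMap.range_eq_top.2 (LinearMap.dualMap_surjective_of_injective
      (Submodule.inclusion_injective hWV)))
  exact eq_zero_of_map_eq_zero_of_map_contractRight_eq_zero hs hker hvb h.1 h.2

/-- The elements of superspace annihilated by all functionals of the following form: apply, for
each member of the list, either the derivative or the interior product along it or nothing, then
restrict the fermions to `W`. This is the inverse-system description of the superspace ideal. -/
def vanishing (W : Submodule ℂ (Fin n → ℂ)) : List (Fin n → ℂ) → Submodule ℂ (Superspace n)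
  | [] => LinearMap.ker (restrict W).toLinearMap
  | b :: A => vanishing W A ⊓ (vanishing W A).comap (deriv b) ⊓ (vanishing W A).comap (contr b)

section Vanishing

variable {W : Submodule ℂ (Fin n → ℂ)} {A : List (Fin n → ℂ)} {a : Superspace n}

lemma mem_vanishing_nil : a ∈ vanishing W [] ↔ restrict W a = 0 :=
  Iff.rfl

lemma mem_vanishing_cons {b : Fin n → ℂ} : a ∈ vanishing W (b :: A) ↔
    a ∈ vanishing W A ∧ deriv b a ∈ vanishing W A ∧ contr b a ∈ vanishing W A :=
  and_assoc

lemma mem_vanishing_sup_span_singleton {b : Fin n → ℂ} (hb : b ∉ W) :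
    a ∈ vanishing (W ⊔ Submodule.span ℂ {b}) A ↔ a ∈ vanishing W A ∧ contr b a ∈ vanishing W A := by
  induction A generalizing a with
  | nil => simpa only [mem_vanishing_nil] using restrict_sup_eq_zero_iff hb
  | cons c A ih =>
    simp only [mem_vanishing_cons, ih, contr_deriv, contr_contr b c, neg_mem_iff]
    tauto

lemma contr_mem_vanishing {w : Fin n → ℂ} (hw : w ∈ W) (ha : a ∈ vanishing W A) :
    contr w a ∈ vanishing W A := by
  induction A generalizing a with
  | nil =>
    have hcontr := restrict_contr (⟨w, hw⟩ : W) a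
    rw [mem_vanishing_nil] at ha ⊢
    rw [hcontr, ha, map_zero, LinearMap.zero_apply]
  | cons b A ih =>
    rw [mem_vanishing_cons] at ha ⊢
    rw [← contr_deriv, contr_contr, neg_mem_iff]
    exact ⟨ih ha.1, ih ha.2.1, ih ha.2.2⟩

lemma parity_mem_vanishing (ha : a ∈ vanishing W A) : parity a ∈ vanishing W A := by
  induction A generalizing a with
  | nil =>
    rw [mem_vanishing_nil] at ha ⊢
    rw [restrict_parity, ha, map_zero]
  | cons b A ih =>
    rw [mem_vanishing_cons] at ha ⊢
    rw [← parity_deriv, ← neg_mem_iff (x := contr b _), ← parity_contr]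
    exact ⟨ih ha.1, ih ha.2.1, ih ha.2.2⟩

lemma mul_mem_vanishing_right (ha : a ∈ vanishing W A) (x : Superspace n) :
    a * x ∈ vanishing W A := by
  induction A generalizing a x with
  | nil =>
    rw [mem_vanishing_nil] at ha ⊢
    rw [map_mul, ha, zero_mul]
  | cons b A ih =>
    rw [mem_vanishing_cons] at ha ⊢
    rw [deriv_mul, contr_mul]
    exact ⟨ih ha.1 x, add_mem (ih ha.2.1 x) (ih ha.1 _), add_mem (ih ha.1 _) (ih ha.2.2 _)⟩

lemma mul_mem_vanishing_left (x : Superspace n) (ha : a ∈ vanishing W A) :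
    x * a ∈ vanishing W A := by
  induction A generalizing a x with
  | nil =>
    rw [mem_vanishing_nil] at ha ⊢
    rw [map_mul, ha, mul_zero]
  | cons b A ih =>
    rw [mem_vanishing_cons] at ha ⊢
    rw [deriv_mul, contr_mul]
    exact ⟨ih x ha.1, add_mem (ih _ ha.1) (ih x ha.2.1),
      add_mem (ih x ha.2.2) (ih _ (parity_mem_vanishing ha.1))⟩

lemma euler_mem_vanishing_bot (ha : a ∈ vanishing ⊥ A) : euler a ∈ vanishing ⊥ A := by
  induction A generalizing a with
  | nil =>
    have hform (v : Fin n → ℂ) : restrict ⊥ (form v) = 0 := by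
      rw [restrict_form, Subsingleton.elim (restrictForm ⊥ v) 0, map_zero]
    simp [mem_vanishing_nil, euler_apply, hform]
  | cons b A ih =>
    rw [mem_vanishing_cons] at ha ⊢
    rw [deriv_euler, contr_euler]
    exact ⟨ih ha.1, ih ha.2.1, sub_mem ha.2.1 (ih ha.2.2)⟩

end Vanishing

open Classical in
/-- The number of members of `A`, counted with multiplicity, that are not orthogonal to `v`: the
number `ρ` of the line spanned by `v`. -/
def countNe (A : List (Fin n → ℂ)) (v : Fin n → ℂ) : ℕ :=
  A.countP fun b => b ⬝ᵥ v ≠ 0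

lemma countNe_cons_of_eq {A : List (Fin n → ℂ)} {b v : Fin n → ℂ} (h : b ⬝ᵥ v = 0) :
    countNe (b :: A) v = countNe A v := by
  simp [countNe, h]

lemma countNe_cons_of_ne {A : List (Fin n → ℂ)} {b v : Fin n → ℂ} (h : b ⬝ᵥ v ≠ 0) :
    countNe (b :: A) v = countNe A v + 1 := by
  simp [countNe, h]

lemma countNe_nil (v : Fin n → ℂ) : countNe [] v = 0 :=
  rfl

lemma lin_pow_mem_vanishing (W : Submodule ℂ (Fin n → ℂ)) (A : List (Fin n → ℂ))
    (v : Fin n → ℂ) : lin v ^ (countNe A v + 1) ∈ vanishing W A := by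
  induction A with
  | nil => rw [mem_vanishing_nil, countNe_nil, zero_add, pow_one, restrict_lin]
  | cons b A ih =>
    rw [mem_vanishing_cons, contr_lin_pow]
    by_cases h : b ⬝ᵥ v = 0
    · rw [countNe_cons_of_eq h, deriv_lin_pow_eq_zero h]
      exact ⟨ih, zero_mem _, zero_mem _⟩
    · rw [countNe_cons_of_ne h, deriv_lin_pow]
      exact ⟨pow_succ (lin v) _ ▸ mul_mem_vanishing_right ih _, Submodule.smul_mem _ _ ih,
        zero_mem _⟩

lemma lin_pow_mul_form_mem_vanishing {W : Submodule ℂ (Fin n → ℂ)} (A : List (Fin n → ℂ))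
    {v : Fin n → ℂ} (hv : ∀ w ∈ W, w ⬝ᵥ v = 0) :
    lin v ^ countNe A v * form v ∈ vanishing W A := by
  induction A with
  | nil =>
    rw [mem_vanishing_nil, countNe_nil, pow_zero, one_mul, restrict_form,
      LinearMap.mem_ker.1 (mem_ker_restrictForm.2 hv), map_zero]
  | cons b A ih =>
    rw [mem_vanishing_cons, contr_mul_form, deriv_mul, contr_lin_pow, deriv_form, mul_zero,
      add_zero, zero_mul, sub_zero]
    by_cases h : b ⬝ᵥ v = 0
    · rw [countNe_cons_of_eq h, deriv_lin_pow_eq_zero h, h, zero_mul, zero_smul]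
      exact ⟨ih, zero_mem _, zero_mem _⟩
    · rw [countNe_cons_of_ne h, deriv_lin_pow, smul_mul_assoc]
      refine ⟨?_, Submodule.smul_mem _ _ ih,
        Submodule.smul_mem _ _ (lin_pow_mem_vanishing W A v)⟩
      rw [pow_succ', mul_assoc]
      exact mul_mem_vanishing_left _ ih

end Superspace

/-! ### Spanning products of the inverse system -/

lemma exists_orthogonal_family {n : ℕ} (W : Submodule ℂ (Fin n → ℂ)) : ∃ u : Fin n → Fin n → ℂ,
    (∀ l, ∀ w ∈ W, w ⬝ᵥ u l = 0) ∧ ∀ b : Fin n → ℂ, b - (fun l => b ⬝ᵥ u l) ∈ W := by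
  obtain ⟨P, hP⟩ := LinearMap.exists_leftInverse_of_injective W.subtype W.ker_subtype
  -- the rows of the matrix of the projection `b ↦ b - P b` along `W`
  let u : Fin n → Fin n → ℂ := fun l k => ((Pi.single k 1 : Fin n → ℂ) - P (Pi.single k 1)) l
  have hu (b : Fin n → ℂ) (l : Fin n) : b ⬝ᵥ u l = (b - P b) l := by
    conv_rhs => rw [pi_eq_sum_univ' b]
    simp [u, dotProduct, mul_sub, Finset.sum_sub_distrib, Pi.single_apply]
  refine ⟨u, fun l w hw => ?_, fun b => ?_⟩
  · have hPw : P w = ⟨w, hw⟩ := LinearMap.congr_fun hP ⟨w, hw⟩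
    rw [hu, hPw, sub_self, Pi.zero_apply]
  · have hPb : b - (fun l => b ⬝ᵥ u l) = P b := by
      rw [funext (hu b), sub_sub_cancel]
    exact hPb ▸ (P b).2

lemma exists_orthogonal_of_notMem {n : ℕ} {W : Submodule ℂ (Fin n → ℂ)} {b : Fin n → ℂ}
    (hb : b ∉ W) : ∃ v : Fin n → ℂ, (∀ w ∈ W, w ⬝ᵥ v = 0) ∧ b ⬝ᵥ v ≠ 0 := by
  obtain ⟨u, hu, h⟩ := exists_orthogonal_family W
  obtain ⟨l, hl⟩ : ∃ l, b ⬝ᵥ u l ≠ 0 := by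
    by_contra! hc
    exact hb (by simpa [hc, ← Pi.zero_def] using h b)
  exact ⟨u l, hu l, hl⟩

namespace Superspace

open MvPolynomial

variable {n : ℕ}

/-- The elements of bidegree `(i, j)` whose derivatives in the directions of `W` vanish. -/
def piece (W : Submodule ℂ (Fin n → ℂ)) (i j : ℕ) : Submodule ℂ (Superspace n) :=
  bidegree n i j ⊓ ⨅ w ∈ W, LinearMap.ker (deriv w)

section Piece

variable {W : Submodule ℂ (Fin n → ℂ)} {i j : ℕ} {a : Superspace n}

lemma mem_piece : a ∈ piece W i j ↔ a ∈ bidegree n i j ∧ ∀ w ∈ W, deriv w a = 0 := by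
  simp [piece]

lemma piece_bot (i j : ℕ) : piece (⊥ : Submodule ℂ (Fin n → ℂ)) i j = bidegree n i j := by
  ext a
  simp [mem_piece]

lemma piece_zero (W : Submodule ℂ (Fin n → ℂ)) (j : ℕ) : piece W 0 j = bidegree n 0 j :=
  inf_eq_left.2 fun a ha => by simp [deriv_eq_zero_of_mem_bidegree _ ha]

lemma mem_piece_sup_span_singleton {b : Fin n → ℂ} :
    a ∈ piece (W ⊔ Submodule.span ℂ {b}) i j ↔ a ∈ piece W i j ∧ deriv b a = 0 := by
  rw [mem_piece, mem_piece, and_assoc]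
  refine and_congr_right fun _ => ⟨fun h => ⟨fun w hw => h w (Submodule.mem_sup_left hw),
    h b (Submodule.mem_sup_right (Submodule.mem_span_singleton_self b))⟩, fun h => ?_⟩
  have hle : W ⊔ Submodule.span ℂ {b} ≤ LinearMap.ker (deriv.flip a) :=
    sup_le h.1 ((Submodule.span_singleton_le_iff_mem _ _).2 h.2)
  exact hle

lemma deriv_mem_piece (b : Fin n → ℂ) (ha : a ∈ piece W (i + 1) j) : deriv b a ∈ piece W i j := by
  rw [mem_piece] at ha ⊢
  refine ⟨deriv_mem_bidegree b ha.1, fun w hw => ?_⟩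
  rw [deriv_comm, ha.2 w hw, map_zero]

lemma mul_lin_pow_mem_piece {v : Fin n → ℂ} (hv : ∀ w ∈ W, w ⬝ᵥ v = 0) (k : ℕ)
    (ha : a ∈ piece W i j) : a * lin v ^ k ∈ piece W (i + k) j := by
  rw [mem_piece] at ha ⊢
  refine ⟨mul_lin_pow_mem_bidegree v k ha.1, fun w hw => ?_⟩
  rw [deriv_mul, ha.2 w hw, deriv_lin_pow_eq_zero (hv w hw), zero_mul, mul_zero, add_zero]

lemma mul_form_mem_piece (v : Fin n → ℂ) (ha : a ∈ piece W i j) :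
    a * form v ∈ piece W i (j + 1) := by
  rw [mem_piece] at ha ⊢
  refine ⟨mul_form_mem_bidegree v ha.1, fun w hw => ?_⟩
  rw [deriv_mul, ha.2 w hw, deriv_form, zero_mul, mul_zero, add_zero]

-- Integration by parts, with an induction on the bosonic degree of `g`.
lemma exists_deriv_mul_lin_pow {b v : Fin n → ℂ} (hv : ∀ w ∈ W, w ⬝ᵥ v = 0) (hb : b ⬝ᵥ v ≠ 0)
    (k : ℕ) {g : Superspace n} (hg : g ∈ piece W i j) :
    ∃ h ∈ piece W i j, deriv b (h * lin v ^ (k + 1)) = g * lin v ^ k := by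
  have hk (k : ℕ) : (k + 1 : ℂ) * (b ⬝ᵥ v) ≠ 0 := mul_ne_zero (Nat.cast_add_one_ne_zero k) hb
  induction i generalizing k g with
  | zero =>
    refine ⟨((k + 1 : ℂ) * (b ⬝ᵥ v))⁻¹ • g, Submodule.smul_mem _ _ hg, ?_⟩
    rw [deriv_mul, map_smul, deriv_eq_zero_of_mem_bidegree b (mem_piece.1 hg).1, smul_zero,
      zero_mul, zero_add, deriv_lin_pow, smul_mul_smul_comm, inv_mul_cancel₀ (hk k), one_smul]
  | succ i ih =>
    obtain ⟨h, hh, hderiv⟩ := ih (k + 1) (deriv_mem_piece b hg)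
    have hmem : h * lin v ∈ piece W (i + 1) j := by simpa using mul_lin_pow_mem_piece hv 1 hh
    refine ⟨((k + 1 : ℂ) * (b ⬝ᵥ v))⁻¹ • (g - h * lin v),
      Submodule.smul_mem _ _ (sub_mem hg hmem), ?_⟩
    rw [smul_mul_assoc, map_smul, sub_mul, mul_assoc, ← pow_succ', map_sub, hderiv, deriv_mul,
      deriv_lin_pow, add_sub_cancel_left, mul_smul_comm, smul_smul, inv_mul_cancel₀ (hk k),
      one_smul]

lemma exists_mem_piece_deriv_eq {b : Fin n → ℂ} (hb : b ∉ W) (ha : a ∈ piece W i j) :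
    ∃ f ∈ piece W (i + 1) j, deriv b f = a := by
  obtain ⟨u, hu, hbu⟩ := exists_orthogonal_of_notMem hb
  obtain ⟨h, hh, hderiv⟩ := exists_deriv_mul_lin_pow hu hbu 0 ha
  rw [pow_zero, mul_one] at hderiv
  exact ⟨_, mul_lin_pow_mem_piece hu _ hh, hderiv⟩

end Piece

/-- The span of the products `g λ_v ^ (ρ(v) + 1)` and `g λ_v ^ ρ(v) dλ_v` of bidegree `(i, j)`, with
`g` and `λ_v` constant in the directions of `W`. For `W = 0` this is a graded piece of the
superspace ideal. -/
def powerPiece (W : Submodule ℂ (Fin n → ℂ)) (A : List (Fin n → ℂ)) (i j : ℕ) :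
    Submodule ℂ (Superspace n) :=
  Submodule.span ℂ {a | ∃ v, (∀ w ∈ W, w ⬝ᵥ v = 0) ∧
    ((∃ k, ∃ g ∈ piece W k j, k + (countNe A v + 1) = i ∧ a = g * lin v ^ (countNe A v + 1)) ∨
    (∃ k l, ∃ g ∈ piece W k l, k + countNe A v = i ∧ l + 1 = j ∧
      a = g * lin v ^ countNe A v * form v))}

section PowerPiece

variable {W : Submodule ℂ (Fin n → ℂ)} {A : List (Fin n → ℂ)}

lemma mul_lin_pow_mem_powerPiece {v : Fin n → ℂ} (hv : ∀ w ∈ W, w ⬝ᵥ v = 0) {k j : ℕ}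
    {g : Superspace n} (hg : g ∈ piece W k j) :
    g * lin v ^ (countNe A v + 1) ∈ powerPiece W A (k + (countNe A v + 1)) j :=
  Submodule.subset_span ⟨v, hv, Or.inl ⟨k, g, hg, rfl, rfl⟩⟩

lemma mul_lin_pow_mul_form_mem_powerPiece {v : Fin n → ℂ} (hv : ∀ w ∈ W, w ⬝ᵥ v = 0) {k j : ℕ}
    {g : Superspace n} (hg : g ∈ piece W k j) :
    g * lin v ^ countNe A v * form v ∈ powerPiece W A (k + countNe A v) (j + 1) :=
  Submodule.subset_span ⟨v, hv, Or.inr ⟨k, j, g, hg, rfl, rfl, rfl⟩⟩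

lemma powerPiece_le_piece (W : Submodule ℂ (Fin n → ℂ)) (A : List (Fin n → ℂ)) (i j : ℕ) :
    powerPiece W A i j ≤ piece W i j := by
  rw [powerPiece, Submodule.span_le]
  rintro a ⟨v, hv, ⟨k, g, hg, rfl, rfl⟩ | ⟨k, l, g, hg, rfl, rfl, rfl⟩⟩
  · exact mul_lin_pow_mem_piece hv _ hg
  · exact mul_form_mem_piece v (mul_lin_pow_mem_piece hv _ hg)

lemma powerPiece_le_vanishing (W : Submodule ℂ (Fin n → ℂ)) (A : List (Fin n → ℂ)) (i j : ℕ) :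
    powerPiece W A i j ≤ vanishing W A := by
  rw [powerPiece, Submodule.span_le]
  rintro _ ⟨v, hv, ⟨k, g, -, -, rfl⟩ | ⟨k, l, g, -, -, -, rfl⟩⟩
  · exact mul_mem_vanishing_left _ (lin_pow_mem_vanishing W A v)
  · rw [mul_assoc]
    exact mul_mem_vanishing_left _ (lin_pow_mul_form_mem_vanishing A hv)

lemma powerPiece_le_powerPiece_cons_of_mem {b : Fin n → ℂ} (hb : b ∈ W) (i j : ℕ) :
    powerPiece W A i j ≤ powerPiece W (b :: A) i j := by
  rw [powerPiece, Submodule.span_le]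
  rintro a ⟨v, hv, ⟨k, g, hg, rfl, rfl⟩ | ⟨k, l, g, hg, rfl, rfl, rfl⟩⟩ <;>
    rw [← countNe_cons_of_eq (hv b hb)]
  · exact mul_lin_pow_mem_powerPiece hv hg
  · exact mul_lin_pow_mul_form_mem_powerPiece hv hg

lemma powerPiece_sup_span_singleton_le (b : Fin n → ℂ) (i j : ℕ) :
    powerPiece (W ⊔ Submodule.span ℂ {b}) A i j ≤ powerPiece W (b :: A) i j := by
  rw [powerPiece, Submodule.span_le]
  rintro a ⟨v, hv, ⟨k, g, hg, rfl, rfl⟩ | ⟨k, l, g, hg, rfl, rfl, rfl⟩⟩ <;>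
    rw [← countNe_cons_of_eq
      (hv b (Submodule.mem_sup_right (Submodule.mem_span_singleton_self b)))]
  · exact mul_lin_pow_mem_powerPiece (fun w hw => hv w (Submodule.mem_sup_left hw))
      (mem_piece_sup_span_singleton.1 hg).1
  · exact mul_lin_pow_mul_form_mem_powerPiece (fun w hw => hv w (Submodule.mem_sup_left hw))
      (mem_piece_sup_span_singleton.1 hg).1

-- If `b` is not orthogonal to `v`, integrate by parts along `λ_v`, which raises the exponent as
-- `ρ(v)` demands; otherwise `λ_v` is constant along `b` and only the cofactor has to be integrated.
lemma exists_deriv_mul_lin_pow_cons {b : Fin n → ℂ} (hb : b ∉ W) {v : Fin n → ℂ}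
    (hv : ∀ w ∈ W, w ⬝ᵥ v = 0) {k j : ℕ} {g : Superspace n} (hg : g ∈ piece W k j) (e : ℕ) :
    ∃ l, ∃ h ∈ piece W l j, l + countNe (b :: A) v = k + countNe A v + 1 ∧
      deriv b (h * lin v ^ (countNe (b :: A) v + e)) = g * lin v ^ (countNe A v + e) := by
  by_cases hbv : b ⬝ᵥ v = 0
  · obtain ⟨h, hh, hderiv⟩ := exists_mem_piece_deriv_eq hb hg
    refine ⟨k + 1, h, hh, by rw [countNe_cons_of_eq hbv]; ring, ?_⟩
    rw [deriv_mul, hderiv, deriv_lin_pow_eq_zero hbv, mul_zero, add_zero, countNe_cons_of_eq hbv]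
  · obtain ⟨h, hh, hderiv⟩ := exists_deriv_mul_lin_pow hv hbv (countNe A v + e) hg
    refine ⟨k, h, hh, by rw [countNe_cons_of_ne hbv]; ring, ?_⟩
    rw [countNe_cons_of_ne hbv, add_right_comm, hderiv]

lemma exists_mem_powerPiece_deriv_eq {b : Fin n → ℂ} (hb : b ∉ W) {i j : ℕ} {g : Superspace n}
    (hg : g ∈ powerPiece W A i j) : ∃ f ∈ powerPiece W (b :: A) (i + 1) j, deriv b f = g := by
  have hle : powerPiece W A i j ≤ (powerPiece W (b :: A) (i + 1) j).map (deriv b) := by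
    rw [powerPiece, Submodule.span_le]
    rintro a ⟨v, hv, ⟨k, c, hc, rfl, rfl⟩ | ⟨k, l, c, hc, rfl, rfl, rfl⟩⟩
    · obtain ⟨m, h, hh, hm, hderiv⟩ := exists_deriv_mul_lin_pow_cons (A := A) hb hv hc 1
      refine ⟨_, ?_, hderiv⟩
      rw [← add_assoc k, ← hm, add_assoc m]
      exact mul_lin_pow_mem_powerPiece hv hh
    · obtain ⟨m, h, hh, hm, hderiv⟩ := exists_deriv_mul_lin_pow_cons (A := A) hb hv hc 0
      refine ⟨h * lin v ^ countNe (b :: A) v * form v, ?_, ?_⟩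
      · rw [← hm]
        exact mul_lin_pow_mul_form_mem_powerPiece hv hh
      · rw [deriv_mul, deriv_form, mul_zero, add_zero]
        exact congrArg (· * form v) hderiv
  exact hle hg

lemma sum_smul_lin_single (u : Fin n → ℂ) : ∑ k, u k • lin (Pi.single k 1) = lin u := by
  simp only [lin, TensorProduct.smul_tmul', ← TensorProduct.sum_tmul]
  congr 1
  simp [linearForm, Pi.single_apply, MvPolynomial.smul_eq_C_mul]

lemma piece_succ_le_powerPiece_nil (W : Submodule ℂ (Fin n → ℂ)) (i j : ℕ) :
    piece W (i + 1) j ≤ powerPiece W [] (i + 1) j := by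
  intro a ha
  obtain ⟨u, hu, hsub⟩ := exists_orthogonal_family W
  have hderiv (b : Fin n → ℂ) : deriv b a = ∑ l, (b ⬝ᵥ u l) • deriv (Pi.single l 1) a := by
    have hzero := (mem_piece.1 ha).2 _ (hsub b)
    rw [map_sub, LinearMap.sub_apply, sub_eq_zero] at hzero
    rw [hzero, pi_eq_sum_univ' fun l => b ⬝ᵥ u l, map_sum, LinearMap.sum_apply]
    simp only [map_smul, LinearMap.smul_apply]
  -- Euler's identity, with the coordinate forms replaced by their projections orthogonal to `W`
  have hsum : ((i + 1 : ℕ) : ℂ) • a = ∑ l, deriv (Pi.single l 1) a * lin (u l) := by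
    simp only [← sum_deriv_mul_lin (mem_piece.1 ha).1, ← sum_smul_lin_single (u _),
      Finset.mul_sum]
    rw [Finset.sum_comm]
    refine Finset.sum_congr rfl fun k _ => ?_
    conv_lhs => rw [hderiv]
    simp only [Finset.sum_mul, smul_mul_assoc, mul_smul_comm, single_one_dotProduct]
  have hmem : ((i + 1 : ℕ) : ℂ) • a ∈ powerPiece W [] (i + 1) j := by
    rw [hsum]
    refine Submodule.sum_mem _ fun l _ => ?_
    simpa [countNe_nil] using
      mul_lin_pow_mem_powerPiece (A := []) (hu l) (deriv_mem_piece (Pi.single l 1) ha)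
  exact (Submodule.smul_mem_iff _ (Nat.cast_ne_zero.2 i.succ_ne_zero)).1 hmem

lemma exists_eq_one_tmul_of_mem_bidegree_zero {j : ℕ} {a : Superspace n}
    (ha : a ∈ bidegree n 0 j) : ∃ ω ∈ ⋀[ℂ]^j (Fin n → ℂ), a = 1 ⊗ₜ ω := by
  have hle : bidegree n 0 j ≤ (⋀[ℂ]^j (Fin n → ℂ)).map (TensorProduct.mk ℂ _ _ 1) :=
    bidegree_le_iff.2 fun p ω hp hω => by
      have hC := totalDegree_eq_zero_iff_eq_C.1 (Nat.le_zero.1 hp.totalDegree_le)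
      refine ⟨coeff 0 p • ω, Submodule.smul_mem _ _ hω, ?_⟩
      conv_rhs => rw [hC, ← mul_one (C _), ← MvPolynomial.smul_eq_C_mul]
      exact TensorProduct.tmul_smul _ _ _
  obtain ⟨ω, hω, rfl⟩ := hle ha
  exact ⟨ω, hω, rfl⟩

lemma bidegree_zero_inf_ker_restrict_le (W : Submodule ℂ (Fin n → ℂ)) (j : ℕ) :
    bidegree n 0 j ⊓ LinearMap.ker (restrict W).toLinearMap ≤ powerPiece W [] 0 j := by
  rintro a ⟨ha, hWa : restrict W a = 0⟩
  obtain ⟨ω, hω, rfl⟩ := exists_eq_one_tmul_of_mem_bidegree_zero ha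
  rw [restrict_tmul, map_one, one_smul] at hWa
  cases j with
  | zero =>
    rw [exteriorPower_zero, Submodule.mem_one] at hω
    obtain ⟨c, rfl⟩ := hω
    rw [AlgHom.commutes, ExteriorAlgebra.algebraMap_eq_zero_iff] at hWa
    rw [hWa, map_zero, TensorProduct.tmul_zero]
    exact zero_mem _
  | succ j =>
    obtain ⟨s, hs⟩ := (restrictForm W).exists_rightInverse_of_surjective
      (LinearMap.range_eq_top.2 (restrictForm_surjective W))
    have hle : ⋀[ℂ]^j (Fin n → ℂ) * (LinearMap.ker (restrictForm W)).map (ExteriorAlgebra.ι ℂ) ≤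
        (powerPiece W [] 0 (j + 1)).comap (TensorProduct.mk ℂ _ _ 1) := by
      refine Submodule.mul_le.2 ?_
      rintro η hη _ ⟨v, hv, rfl⟩
      have hmem : (1 : MvPolynomial (Fin n) ℂ) ⊗ₜ η ∈ piece W 0 j := by
        rw [piece_zero]
        exact tmul_mem_bidegree (isHomogeneous_one _ _) hη
      simpa [countNe_nil, form_apply] using
        mul_lin_pow_mul_form_mem_powerPiece (A := []) (mem_ker_restrictForm.1 hv) hmem
    exact hle (mem_exteriorPower_mul_map_ι_ker_of_map_eq_zero hs hω hWa)

theorem piece_inf_vanishing_le_powerPiece (W : Submodule ℂ (Fin n → ℂ)) (A : List (Fin n → ℂ))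
    (i j : ℕ) : piece W i j ⊓ vanishing W A ≤ powerPiece W A i j := by
  induction A generalizing W i j with
  | nil =>
    cases i with
    | zero => rw [piece_zero]; exact bidegree_zero_inf_ker_restrict_le W j
    | succ i => exact inf_le_left.trans (piece_succ_le_powerPiece_nil W i j)
  | cons b A ih =>
    rintro a ⟨ha, hvan⟩
    by_cases hb : b ∈ W
    · exact powerPiece_le_powerPiece_cons_of_mem hb i j
        (ih W i j ⟨ha, (mem_vanishing_cons.1 hvan).1⟩)
    have hconst {i : ℕ} {a : Superspace n} (ha : a ∈ piece W i j)
        (hvan : a ∈ vanishing W (b :: A)) (hab : deriv b a = 0) :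
        a ∈ powerPiece W (b :: A) i j := by
      rw [mem_vanishing_cons] at hvan
      exact powerPiece_sup_span_singleton_le b i j (ih _ i j ⟨mem_piece_sup_span_singleton.2
        ⟨ha, hab⟩, (mem_vanishing_sup_span_singleton hb).2 ⟨hvan.1, hvan.2.2⟩⟩)
    cases i with
    | zero => exact hconst ha hvan (deriv_eq_zero_of_mem_bidegree b (mem_piece.1 ha).1)
    | succ i =>
      obtain ⟨f, hf, hderiv⟩ := exists_mem_powerPiece_deriv_eq hb
        (ih W i j ⟨deriv_mem_piece b ha, (mem_vanishing_cons.1 hvan).2.1⟩)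
      have hsub := hconst (sub_mem ha (powerPiece_le_piece _ _ _ _ hf))
        (sub_mem hvan (powerPiece_le_vanishing _ _ _ _ hf)) (by rw [map_sub, hderiv, sub_self])
      exact (Submodule.sub_mem_iff_left _ hf).1 hsub

end PowerPiece

end Superspace

/-! ### Deletion and contraction -/

lemma finrank_map_add_finrank_inf_ker {K E F : Type*} [DivisionRing K] [AddCommGroup E] [Module K E]
    [AddCommGroup F] [Module K F] (V : Submodule K E) [FiniteDimensional K V] (f : E →ₗ[K] F) :
    Module.finrank K (V.map f) + Module.finrank K ↥(V ⊓ LinearMap.ker f) = Module.finrank K V := by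
  rw [← LinearMap.finrank_range_add_finrank_ker (f.domRestrict V), LinearMap.range_domRestrict,
    LinearMap.ker_domRestrict, ← Submodule.map_comap_subtype, Submodule.finrank_map_subtype_eq]

lemma map_exteriorPower_of_surjective {R M N : Type*} [CommRing R] [AddCommGroup M] [Module R M]
    [AddCommGroup N] [Module R N] {f : M →ₗ[R] N} (hf : Function.Surjective f) (j : ℕ) :
    (⋀[R]^j M).map (ExteriorAlgebra.map f).toLinearMap = ⋀[R]^j N := by
  rw [Submodule.map_pow, ExteriorAlgebra.ι_range_map_map, LinearMap.range_eq_top.2 hf,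
    Submodule.map_top]

/-- The exponent of the monomial `q ^ i * t ^ j`. -/
def qtExp (i j : ℕ) : Fin 2 →₀ ℕ := Finsupp.single 0 i + Finsupp.single 1 j

lemma qtExp_apply_zero_one (e : Fin 2 →₀ ℕ) : qtExp (e 0) (e 1) = e := by
  ext k
  fin_cases k <;> simp [qtExp]

section Coefficients

open MvPolynomial

variable {R : Type*} [CommSemiring R]

lemma coeff_qtExp_one (i j : ℕ) :
    coeff (qtExp i j) (1 : MvPolynomial (Fin 2) R) = if i = 0 ∧ j = 0 then 1 else 0 := by
  simp [coeff_one, qtExp, Finsupp.ext_iff, Fin.forall_fin_two, eq_comm]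

lemma coeff_qtExp_succ_X_zero_mul (i j : ℕ) (p : MvPolynomial (Fin 2) R) :
    coeff (qtExp (i + 1) j) (X 0 * p) = coeff (qtExp i j) p := by
  rw [← coeff_X_mul (qtExp i j) 0 p, qtExp, qtExp, Finsupp.single_add]
  abel_nf

lemma coeff_qtExp_zero_X_zero_mul (j : ℕ) (p : MvPolynomial (Fin 2) R) :
    coeff (qtExp 0 j) (X 0 * p) = 0 := by
  rw [coeff_X_mul', if_neg (by simp [qtExp])]

lemma coeff_qtExp_succ_X_one_mul (i j : ℕ) (p : MvPolynomial (Fin 2) R) :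
    coeff (qtExp i (j + 1)) (X 1 * p) = coeff (qtExp i j) p := by
  rw [← coeff_X_mul (qtExp i j) 1 p, qtExp, qtExp, Finsupp.single_add]
  abel_nf

lemma coeff_qtExp_zero_X_one_mul (i : ℕ) (p : MvPolynomial (Fin 2) R) :
    coeff (qtExp i 0) (X 1 * p) = 0 := by
  rw [coeff_X_mul', if_neg (by simp [qtExp])]

lemma coeff_one_add_X_one_pow (k i j : ℕ) :
    coeff (qtExp i j) ((1 + X 1 : MvPolynomial (Fin 2) R) ^ k) =
      if i = 0 then (k.choose j : R) else 0 := by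
  induction k generalizing j with
  | zero => cases j <;> simp [coeff_qtExp_one]
  | succ k ih =>
    rw [pow_succ', add_mul, one_mul, coeff_add, ih]
    cases j with
    | zero => simp [coeff_qtExp_zero_X_one_mul]
    | succ j =>
      rw [coeff_qtExp_succ_X_one_mul, ih, Nat.choose_succ_succ', Nat.cast_add]
      split_ifs
      · exact add_comm _ _
      · exact add_zero 0

end Coefficients

namespace Superspace

open MvPolynomial

variable {n : ℕ}

instance (W : Submodule ℂ (Fin n → ℂ)) (i j : ℕ) : FiniteDimensional ℂ (piece W i j) :=
  Submodule.finiteDimensional_of_le (S₂ := bidegree n i j) inf_le_left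

lemma bidegree_succ_le_ker_restrict (W : Submodule ℂ (Fin n → ℂ)) (i j : ℕ) :
    bidegree n (i + 1) j ≤ LinearMap.ker (restrict W).toLinearMap :=
  bidegree_le_iff.2 fun p ω hp _ => by
    have hp₀ : aeval (0 : Fin n → ℂ) p = 0 := by
      rw [aeval_zero, constantCoeff_eq, hp.coeff_eq_zero (by simp), map_zero]
    change restrict W (p ⊗ₜ ω) = 0
    rw [restrict_tmul, hp₀, zero_smul]

lemma map_restrict_bidegree_zero (W : Submodule ℂ (Fin n → ℂ)) (j : ℕ) :
    (bidegree n 0 j).map (restrict W).toLinearMap = ⋀[ℂ]^j (Module.Dual ℂ W) := by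
  rw [← map_exteriorPower_of_surjective (restrictForm_surjective W)]
  apply le_antisymm
  · rintro _ ⟨a, ha, rfl⟩
    obtain ⟨ω, hω, rfl⟩ := exists_eq_one_tmul_of_mem_bidegree_zero ha
    exact ⟨ω, hω, by simp [restrict_tmul]⟩
  · rintro _ ⟨ω, hω, rfl⟩
    exact ⟨1 ⊗ₜ ω, tmul_mem_bidegree (isHomogeneous_one _ _) hω, by simp [restrict_tmul]⟩

lemma choose_add_finrank_bidegree_zero_inf_ker_restrict (W : Submodule ℂ (Fin n → ℂ)) (j : ℕ) :
    (Module.finrank ℂ W).choose j +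
        Module.finrank ℂ ↥(bidegree n 0 j ⊓ LinearMap.ker (restrict W).toLinearMap) =
      Module.finrank ℂ (bidegree n 0 j) := by
  have h := finrank_map_add_finrank_inf_ker (bidegree n 0 j) (restrict W).toLinearMap
  rwa [map_restrict_bidegree_zero, exteriorPower.finrank_eq, Subspace.dual_finrank_eq] at h

section Recursion

variable {W : Submodule ℂ (Fin n → ℂ)} {A : List (Fin n → ℂ)} {b : Fin n → ℂ}

lemma piece_inf_vanishing_cons_of_mem (hb : b ∈ W) (i j : ℕ) :
    piece W i j ⊓ vanishing W (b :: A) = piece W i j ⊓ vanishing W A := by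
  ext a
  rw [Submodule.mem_inf, Submodule.mem_inf]
  refine and_congr_right fun ha => ?_
  rw [mem_vanishing_cons, (mem_piece.1 ha).2 b hb]
  exact ⟨fun h => h.1, fun h => ⟨h, zero_mem _, contr_mem_vanishing hb h⟩⟩

lemma piece_inf_ker_deriv (i j : ℕ) :
    piece W i j ⊓ LinearMap.ker (deriv b) = piece (W ⊔ Submodule.span ℂ {b}) i j :=
  Submodule.ext fun _ => mem_piece_sup_span_singleton.symm

lemma piece_inf_vanishing_cons_inf_ker_deriv (hb : b ∉ W) (i j : ℕ) :
    piece W i j ⊓ vanishing W (b :: A) ⊓ LinearMap.ker (deriv b) =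
      piece (W ⊔ Submodule.span ℂ {b}) i j ⊓ vanishing (W ⊔ Submodule.span ℂ {b}) A := by
  ext a
  simp only [Submodule.mem_inf, mem_vanishing_cons, LinearMap.mem_ker,
    mem_piece_sup_span_singleton, mem_vanishing_sup_span_singleton hb]
  refine ⟨fun h => ⟨⟨h.1.1, h.2⟩, h.1.2.1, h.1.2.2.2⟩, fun h => ⟨⟨h.1.1, h.2.1, ?_, h.2.2⟩, h.1.2⟩⟩
  rw [h.1.2]
  exact zero_mem _

lemma map_deriv_piece (hb : b ∉ W) (i j : ℕ) :
    (piece W (i + 1) j).map (deriv b) = piece W i j := by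
  apply le_antisymm
  · rintro _ ⟨a, ha, rfl⟩
    exact deriv_mem_piece b ha
  · exact fun g hg => exists_mem_piece_deriv_eq hb hg

lemma map_deriv_piece_inf_vanishing_cons (hb : b ∉ W) (i j : ℕ) :
    (piece W (i + 1) j ⊓ vanishing W (b :: A)).map (deriv b) = piece W i j ⊓ vanishing W A := by
  apply le_antisymm
  · rintro _ ⟨a, ha, rfl⟩
    exact ⟨deriv_mem_piece b ha.1, (mem_vanishing_cons.1 ha.2).2.1⟩
  · intro g hg
    obtain ⟨f, hf, hderiv⟩ := exists_mem_powerPiece_deriv_eq hb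
      (piece_inf_vanishing_le_powerPiece W A i j hg)
    exact ⟨f, ⟨powerPiece_le_piece _ _ _ _ hf, powerPiece_le_vanishing _ _ _ _ hf⟩, hderiv⟩

end Recursion

open Classical in
/-- The deletion-contraction polynomial of the vectors `A` modulo the subspace `W`; in terms of the
Tutte polynomial of the matroid of `A` in `ℂⁿ ⧸ W`, of rank `r`, it is
`(1 + t) ^ (dim W + r) * q ^ (|A| - r) * T ((1 + q + t) / (1 + t), 1 / q)`. -/
def hilbPoly : List (Fin n → ℂ) → Submodule ℂ (Fin n → ℂ) → MvPolynomial (Fin 2) ℕ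
  | [], W => (1 + X 1) ^ Module.finrank ℂ W
  | b :: A, W => if b ∈ W then hilbPoly A W
      else X 0 * hilbPoly A W + hilbPoly A (W ⊔ Submodule.span ℂ {b})

theorem coeff_hilbPoly_add_finrank (A : List (Fin n → ℂ)) (W : Submodule ℂ (Fin n → ℂ))
    (i j : ℕ) : coeff (qtExp i j) (hilbPoly A W) + Module.finrank ℂ ↥(piece W i j ⊓ vanishing W A) =
      Module.finrank ℂ (piece W i j) := by
  induction A generalizing W i j with
  | nil =>
    rw [hilbPoly, coeff_one_add_X_one_pow]
    cases i with
    | zero =>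
      rw [piece_zero, if_pos rfl]
      exact choose_add_finrank_bidegree_zero_inf_ker_restrict W j
    | succ i =>
      have hle : piece W (i + 1) j ≤ vanishing W [] :=
        inf_le_left.trans (bidegree_succ_le_ker_restrict W i j)
      rw [if_neg i.succ_ne_zero, zero_add, inf_eq_left.2 hle]
  | cons b A ih =>
    rw [hilbPoly]
    split_ifs with hb
    · rw [piece_inf_vanishing_cons_of_mem hb, ih]
    have hker := piece_inf_vanishing_cons_inf_ker_deriv (A := A) hb i j
    rw [coeff_add]
    cases i with
    | zero =>
      have hle : piece W 0 j ≤ LinearMap.ker (deriv b) := fun a ha =>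
        deriv_eq_zero_of_mem_bidegree b (mem_piece.1 ha).1
      have h := ih (W ⊔ Submodule.span ℂ {b}) 0 j
      rw [← hker, inf_eq_left.2 (inf_le_left.trans hle), ← piece_inf_ker_deriv,
        inf_eq_left.2 hle] at h
      rw [coeff_qtExp_zero_X_zero_mul, zero_add, h]
    | succ i =>
      have : FiniteDimensional ℂ ↥(piece W (i + 1) j ⊓ vanishing W (b :: A)) :=
        Submodule.finiteDimensional_of_le inf_le_left
      have hV := finrank_map_add_finrank_inf_ker (piece W (i + 1) j) (deriv b)
      have hN := finrank_map_add_finrank_inf_ker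
        (piece W (i + 1) j ⊓ vanishing W (b :: A)) (deriv b)
      rw [map_deriv_piece hb, piece_inf_ker_deriv] at hV
      rw [map_deriv_piece_inf_vanishing_cons hb, hker] at hN
      rw [coeff_qtExp_succ_X_zero_mul, ← hV, ← hN, ← ih W, ← ih (W ⊔ Submodule.span ℂ {b})]
      ring

end Superspace

section QuotientPieces

variable {R R' : Type*} [Ring R] [Algebra ℂ R] [Ring R'] [Algebra ℂ R']

lemma ker_restrictScalars_mkQ (I : Ideal R) :
    LinearMap.ker ((Submodule.mkQ I).restrictScalars ℂ) = I.restrictScalars ℂ := by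
  rw [LinearMap.ker_restrictScalars, Submodule.ker_mkQ]

lemma quotientPieceDim_add_finrank_inf (I : Ideal R) (V : Submodule ℂ R) [FiniteDimensional ℂ V] :
    quotientPieceDim I V + Module.finrank ℂ ↥(V ⊓ I.restrictScalars ℂ) = Module.finrank ℂ V := by
  rw [← ker_restrictScalars_mkQ]
  exact finrank_map_add_finrank_inf_ker V _

lemma quotientPieceDim_map (J : Ideal R') (V : Submodule ℂ R) (T : R →ₗ[ℂ] R')
    [FiniteDimensional ℂ V] :
    quotientPieceDim J (V.map T) + Module.finrank ℂ ↥(V ⊓ (J.restrictScalars ℂ).comap T) =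
      Module.finrank ℂ V := by
  rw [← ker_restrictScalars_mkQ, ← LinearMap.ker_comp, quotientPieceDim, ← Submodule.map_comp]
  exact finrank_map_add_finrank_inf_ker V _

lemma quotientPieceDim_eq_quotientPieceDim_map {I : Ideal R} {J : Ideal R'} {V : Submodule ℂ R}
    [FiniteDimensional ℂ V] {T : R →ₗ[ℂ] R'} (h : ∀ a ∈ V, a ∈ I ↔ T a ∈ J) :
    quotientPieceDim I V = quotientPieceDim J (V.map T) := by
  have hinf : V ⊓ I.restrictScalars ℂ = V ⊓ (J.restrictScalars ℂ).comap T :=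
    Submodule.ext fun a => and_congr_right (h a)
  have hI := quotientPieceDim_add_finrank_inf I V
  rw [hinf, ← quotientPieceDim_map J V T] at hI
  exact Nat.add_right_cancel hI

end QuotientPieces

namespace Multiarrangement

variable {n m : ℕ} (A : Multiarrangement n m)

/-- The normal vectors of `A` as a list, the form of an arrangement on which deletion and
contraction recurse. -/
def normals : List (Fin n → ℂ) := List.ofFn A.normal

lemma span_singleton_le_hyperplane_iff (l : Fin n → ℂ) (i : Fin m) :
    Submodule.span ℂ {l} ≤ A.hyperplane i ↔ A.normal i ⬝ᵥ l = 0 := by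
  rw [Submodule.span_singleton_le_iff_mem, hyperplane, LinearMap.mem_ker]
  simp [dotProduct]

lemma rho_span_singleton (l : Fin n → ℂ) :
    A.rho (Submodule.span ℂ {l}) = Superspace.countNe A.normals l := by
  classical
  rw [rho, Superspace.countNe, normals, List.ofFn_eq_map, List.countP_map,
    Set.ncard_eq_toFinset_card']
  simp only [span_singleton_le_hyperplane_iff, Set.toFinset_ofPred]
  rw [List.countP_eq_length_filter, Finset.card_def, Finset.filter_val, Fin.univ_def,
    Multiset.filter_coe, Multiset.coe_card]
  simp [Function.comp_def]

lemma mul_linearForm_pow_mem_powerIdeal (p : MvPolynomial (Fin n) ℂ) (v : Fin n → ℂ) :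
    p * linearForm v ^ (Superspace.countNe A.normals v + 1) ∈ A.powerIdeal 1 := by
  rcases eq_or_ne v 0 with rfl | hv
  · simp [linearForm]
  · exact Ideal.mul_mem_left _ _ (Ideal.subset_span ⟨v, hv, by rw [rho_span_singleton]⟩)

lemma tmul_one_mem_superIdeal {f : MvPolynomial (Fin n) ℂ} (hf : f ∈ A.powerIdeal 1) :
    f ⊗ₜ 1 ∈ A.superIdeal :=
  Submodule.mem_sInf.2 fun _ hK => hK.2.1 f hf

lemma euler_mem_superIdeal {a : Superspace n} (ha : a ∈ A.superIdeal) :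
    Superspace.euler a ∈ A.superIdeal :=
  Submodule.mem_sInf.2 fun K hK => hK.2.2 a (Submodule.mem_sInf.1 ha K hK)

end Multiarrangement

namespace Superspace

open MvPolynomial

variable {n m : ℕ} (A : Multiarrangement n m)

lemma lin_pow_mem_superIdeal (v : Fin n → ℂ) :
    lin v ^ (countNe A.normals v + 1) ∈ A.superIdeal := by
  rw [lin_pow]
  exact A.tmul_one_mem_superIdeal (by simpa using A.mul_linearForm_pow_mem_powerIdeal 1 v)

lemma lin_pow_mul_form_mem_superIdeal (v : Fin n → ℂ) :
    lin v ^ countNe A.normals v * form v ∈ A.superIdeal := by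
  have h := A.euler_mem_superIdeal (lin_pow_mem_superIdeal A v)
  rw [euler_lin_pow] at h
  exact ((A.superIdeal.restrictScalars ℂ).smul_mem_iff (Nat.cast_add_one_ne_zero _)).1 h

lemma powerPiece_le_superIdeal (i j : ℕ) :
    powerPiece ⊥ A.normals i j ≤ A.superIdeal.restrictScalars ℂ := by
  rw [powerPiece, Submodule.span_le]
  rintro _ ⟨v, -, ⟨k, g, -, -, rfl⟩ | ⟨k, l, g, -, -, -, rfl⟩⟩
  · exact A.superIdeal.mul_mem_left _ (lin_pow_mem_superIdeal A v)
  · rw [mul_assoc]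
    exact A.superIdeal.mul_mem_left _ (lin_pow_mul_form_mem_superIdeal A v)

/-- The space `vanishing W A` as a left ideal. -/
def vanishingIdeal (W : Submodule ℂ (Fin n → ℂ)) (A : List (Fin n → ℂ)) :
    Ideal (Superspace n) where
  carrier := vanishing W A
  add_mem' := add_mem
  zero_mem' := zero_mem _
  smul_mem' x _ ha := mul_mem_vanishing_left x ha

lemma superIdeal_le_vanishingIdeal : A.superIdeal ≤ vanishingIdeal ⊥ A.normals := by
  have hpow : A.powerIdeal 1 ≤
      (vanishingIdeal ⊥ A.normals).comap (Algebra.TensorProduct.includeLeft (S := ℂ)) := by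
    rw [Multiarrangement.powerIdeal, Ideal.span_le]
    rintro _ ⟨v, -, rfl⟩
    change (linearForm v ^ _) ⊗ₜ 1 ∈ vanishing ⊥ A.normals
    rw [A.rho_span_singleton, ← lin_pow]
    exact lin_pow_mem_vanishing ⊥ _ v
  exact sInf_le ⟨⟨fun x h => mul_mem_vanishing_right h x⟩, fun f hf => hpow hf,
    fun _ h => euler_mem_vanishing_bot h⟩

lemma bidegree_inf_vanishing_bot (i j : ℕ) : bidegree n i j ⊓ vanishing ⊥ A.normals =
    bidegree n i j ⊓ A.superIdeal.restrictScalars ℂ := by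
  refine le_antisymm (le_inf inf_le_left ?_)
    (inf_le_inf_left _ fun _ ha => superIdeal_le_vanishingIdeal A ha)
  rw [← piece_bot]
  exact (piece_inf_vanishing_le_powerPiece ⊥ _ i j).trans (powerPiece_le_superIdeal A i j)

lemma mem_powerPiece_of_mem_superIdeal {i j : ℕ} {a : Superspace n} (ha : a ∈ bidegree n i j)
    (h : a ∈ A.superIdeal) : a ∈ powerPiece ⊥ A.normals i j :=
  piece_inf_vanishing_le_powerPiece ⊥ _ i j
    ⟨piece_bot (n := n) i j ▸ ha, superIdeal_le_vanishingIdeal A h⟩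

theorem quotientPieceDim_superIdeal (i j : ℕ) :
    quotientPieceDim A.superIdeal (bidegree n i j) =
      coeff (qtExp i j) (hilbPoly A.normals ⊥) := by
  have h := coeff_hilbPoly_add_finrank A.normals ⊥ i j
  rw [piece_bot, bidegree_inf_vanishing_bot,
    ← quotientPieceDim_add_finrank_inf A.superIdeal (bidegree n i j)] at h
  exact (Nat.add_right_cancel h).symm

end Superspace

/-! ### Top fermionic degree -/

lemma exists_dual_injective_of_finrank_eq_one {K E : Type*} [Field K] [AddCommGroup E] [Module K E]
    {V : Submodule K E} (h : Module.finrank K V = 1) :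
    ∃ e ∈ V, ∃ φ : Module.Dual K E, φ e = 1 ∧ ∀ x ∈ V, φ x = 0 → x = 0 := by
  obtain ⟨⟨v, hv⟩, hv₀, hspan⟩ := finrank_eq_one_iff'.1 h
  have hne : v ≠ 0 := fun hv => hv₀ (Subtype.ext hv)
  obtain ⟨φ, hφ⟩ : ∃ φ : Module.Dual K E, φ v ≠ 0 := by
    by_contra! hc
    exact hne ((Module.forall_dual_apply_eq_zero_iff K v).1 hc)
  refine ⟨(φ v)⁻¹ • v, V.smul_mem _ hv, φ, by simp [hφ], fun x hx hx₀ => ?_⟩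
  obtain ⟨c, hc⟩ := hspan ⟨x, hx⟩
  obtain rfl : c • v = x := congrArg Subtype.val hc
  have hc₀ : c = 0 := by simpa [hφ] using hx₀
  rw [hc₀, zero_smul]

namespace Superspace

open MvPolynomial

variable {n m : ℕ}

/-- Apply a functional to the exterior factor of superspace. -/
def polyPart (φ : Module.Dual ℂ (ExteriorAlgebra ℂ (Fin n → ℂ))) :
    Superspace n →ₗ[ℂ] MvPolynomial (Fin n) ℂ :=
  (TensorProduct.rid ℂ _).toLinearMap ∘ₗ LinearMap.lTensor _ φ

section PolyPart

variable (φ : Module.Dual ℂ (ExteriorAlgebra ℂ (Fin n → ℂ)))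

@[simp] lemma polyPart_tmul (p : MvPolynomial (Fin n) ℂ) (ω : ExteriorAlgebra ℂ (Fin n → ℂ)) :
    polyPart φ (p ⊗ₜ ω) = φ ω • p := by
  simp [polyPart]

lemma polyPart_mul_lin_pow (a : Superspace n) (v : Fin n → ℂ) (k : ℕ) :
    polyPart φ (a * lin v ^ k) = polyPart φ a * linearForm v ^ k := by
  rw [lin_pow]
  induction a using TensorProduct.induction_on with
  | zero => simp
  | add x y hx hy => simp only [add_mul, map_add, hx, hy]
  | tmul p ω => simp

lemma polyPart_mul_form_eq_zero {v : Fin n → ℂ} (hv : ∀ ω, φ (ω * ExteriorAlgebra.ι ℂ v) = 0)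
    (a : Superspace n) : polyPart φ (a * form v) = 0 := by
  induction a using TensorProduct.induction_on with
  | zero => simp
  | add x y hx hy => simp only [add_mul, map_add, hx, hy, add_zero]
  | tmul p ω => simp [form_apply, hv]

variable {φ} {i j : ℕ} {ω : ExteriorAlgebra ℂ (Fin n → ℂ)}

lemma map_polyPart_bidegree (hω : ω ∈ ⋀[ℂ]^j (Fin n → ℂ)) (hφ : φ ω = 1) :
    (bidegree n i j).map (polyPart φ) = homogeneousSubmodule (Fin n) ℂ i := by
  apply le_antisymm
  · rw [Submodule.map_le_iff_le_comap, bidegree_le_iff]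
    intro p η hp _
    rw [Submodule.mem_comap, polyPart_tmul]
    exact Submodule.smul_mem _ _ hp
  · intro p hp
    exact ⟨p ⊗ₜ ω, tmul_mem_bidegree hp hω, by rw [polyPart_tmul, hφ, one_smul]⟩

lemma sub_polyPart_tmul_mem {I : Ideal (Superspace n)} (hω : ω ∈ ⋀[ℂ]^j (Fin n → ℂ))
    (hφ : φ ω = 1) (hker : ∀ η ∈ ⋀[ℂ]^j (Fin n → ℂ), φ η = 0 → 1 ⊗ₜ η ∈ I) {a : Superspace n}
    (ha : a ∈ bidegree n i j) : a - polyPart φ a ⊗ₜ ω ∈ I := by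
  have hle : bidegree n i j ≤ (I.restrictScalars ℂ).comap
      (LinearMap.id - (TensorProduct.mk ℂ _ _).flip ω ∘ₗ polyPart φ) :=
    bidegree_le_iff.2 fun p η _ hη => by
      have hmem := I.mul_mem_left (p ⊗ₜ 1) (hker (η - φ η • ω)
        (sub_mem hη (Submodule.smul_mem _ _ hω)) (by simp [hφ]))
      rw [Algebra.TensorProduct.tmul_mul_tmul, mul_one, one_mul] at hmem
      simpa [TensorProduct.tmul_sub, TensorProduct.smul_tmul'] using hmem
  exact hle ha

theorem quotientPieceDim_bidegree_eq {I : Ideal (Superspace n)}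
    {J : Ideal (MvPolynomial (Fin n) ℂ)} (hω : ω ∈ ⋀[ℂ]^j (Fin n → ℂ)) (hφ : φ ω = 1)
    (hker : ∀ η ∈ ⋀[ℂ]^j (Fin n → ℂ), φ η = 0 → 1 ⊗ₜ η ∈ I)
    (hJ : ∀ f ∈ J, f ⊗ₜ ω ∈ I) (hI : ∀ a ∈ bidegree n i j, a ∈ I → polyPart φ a ∈ J) :
    quotientPieceDim I (bidegree n i j) =
      quotientPieceDim J (homogeneousSubmodule (Fin n) ℂ i) := by
  rw [← map_polyPart_bidegree hω hφ]
  refine quotientPieceDim_eq_quotientPieceDim_map fun a ha => ⟨hI a ha, fun h => ?_⟩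
  have hmem := I.add_mem (sub_polyPart_tmul_mem hω hφ hker ha) (hJ _ h)
  rwa [sub_add_cancel] at hmem

end PolyPart

variable (A : Multiarrangement n m)

theorem quotientPieceDim_bidegree_zero (i : ℕ) :
    quotientPieceDim A.superIdeal (bidegree n i 0) =
      quotientPieceDim (A.powerIdeal 1) (homogeneousSubmodule (Fin n) ℂ i) := by
  refine quotientPieceDim_bidegree_eq (φ := ExteriorAlgebra.algebraMapInv.toLinearMap) (ω := 1)
    (by rw [exteriorPower_zero]; exact Submodule.one_le.1 le_rfl) (by simp) ?_
    (fun f hf => A.tmul_one_mem_superIdeal hf) fun a ha haI => ?_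
  · intro η hη hη₀
    rw [exteriorPower_zero, Submodule.mem_one] at hη
    obtain ⟨c, rfl⟩ := hη
    obtain rfl : c = 0 := by simpa using hη₀
    simp
  · suffices powerPiece ⊥ A.normals i 0 ≤ ((A.powerIdeal 1).restrictScalars ℂ).comap _ from
      this (mem_powerPiece_of_mem_superIdeal A ha haI)
    rw [powerPiece, Submodule.span_le]
    rintro _ ⟨v, -, ⟨k, g, -, -, rfl⟩ | ⟨k, l, g, -, -, hl, -⟩⟩
    · rw [SetLike.mem_coe, Submodule.mem_comap, polyPart_mul_lin_pow]
      exact A.mul_linearForm_pow_mem_powerIdeal _ v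
    · exact absurd hl l.succ_ne_zero

lemma countNe_eq_zero_iff {A : List (Fin n → ℂ)} {v : Fin n → ℂ} :
    countNe A v = 0 ↔ restrictForm (Submodule.span ℂ {b | b ∈ A}) v = 0 := by
  have hle : Submodule.span ℂ {b | b ∈ A} ≤
      LinearMap.ker (dotProductBilin ℂ ℂ (m := Fin n) |>.flip v) ↔ ∀ b ∈ A, b ⬝ᵥ v = 0 :=
    Submodule.span_le
  rw [countNe, List.countP_eq_zero, ← LinearMap.mem_ker, mem_ker_restrictForm]
  exact Iff.trans (by simp) hle.symm

lemma one_tmul_mem_superIdeal_of_map_eq_zero {ω : ExteriorAlgebra ℂ (Fin n → ℂ)}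
    (hω : ExteriorAlgebra.map (restrictForm (Submodule.span ℂ {b | b ∈ A.normals})) ω = 0) :
    1 ⊗ₜ ω ∈ A.superIdeal := by
  set W := Submodule.span ℂ {b | b ∈ A.normals}
  obtain ⟨s, hs⟩ := (restrictForm W).exists_rightInverse_of_surjective
    (LinearMap.range_eq_top.2 (restrictForm_surjective W))
  suffices Ideal.span (ExteriorAlgebra.ι ℂ '' (LinearMap.ker (restrictForm W) : Set _)) ≤
      A.superIdeal.comap (Algebra.TensorProduct.includeRight (R := ℂ)) from
    this (mem_span_ι_ker_of_map_eq_zero hs hω)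
  rw [Ideal.span_le]
  rintro _ ⟨v, hv, rfl⟩
  simpa [countNe_eq_zero_iff.2 hv, form_apply] using lin_pow_mul_form_mem_superIdeal A v

lemma exists_mem_span_dotProduct_ne_zero {A : List (Fin n → ℂ)} {v : Fin n → ℂ}
    (h : countNe A v ≠ 0) : ∃ w ∈ Submodule.span ℂ {b | b ∈ A}, w ⬝ᵥ v ≠ 0 := by
  contrapose! h
  exact countNe_eq_zero_iff.2 (mem_ker_restrictForm.2 h)

lemma map_restrictForm_eq_zero {W : Submodule ℂ (Fin n → ℂ)} {j : ℕ}
    (hj : Module.finrank ℂ W < j) {ω : ExteriorAlgebra ℂ (Fin n → ℂ)}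
    (hω : ω ∈ ⋀[ℂ]^j (Fin n → ℂ)) : ExteriorAlgebra.map (restrictForm W) ω = 0 := by
  have hbot : ⋀[ℂ]^j (Module.Dual ℂ W) = ⊥ := by
    rw [← Submodule.finrank_eq_zero, exteriorPower.finrank_eq, Subspace.dual_finrank_eq,
      Nat.choose_eq_zero_of_lt hj]
  rw [← Submodule.mem_bot ℂ, ← hbot, ← map_exteriorPower_of_surjective (restrictForm_surjective W)]
  exact ⟨ω, hω, rfl⟩

lemma finrank_span_normals : Module.finrank ℂ (Submodule.span ℂ {b | b ∈ A.normals}) = A.rank := by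
  have h : {b | b ∈ A.normals} = A.normal '' ((Finset.univ : Finset (Fin m)) : Set (Fin m)) := by
    ext b
    simp [Multiarrangement.normals, List.mem_ofFn]
  rw [h]
  rfl

section TopForms

variable {A} {ω : ExteriorAlgebra ℂ (Fin n → ℂ)}

lemma contr_mul_form_mem_superIdeal (hω : ω ∈ ⋀[ℂ]^A.rank (Fin n → ℂ)) {w : Fin n → ℂ}
    (hw : w ∈ Submodule.span ℂ {b | b ∈ A.normals}) (v : Fin n → ℂ) :
    contr w (1 ⊗ₜ ω * form v) ∈ A.superIdeal := by
  set W := Submodule.span ℂ {b | b ∈ A.normals}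
  rw [form_apply, Algebra.TensorProduct.tmul_mul_tmul, mul_one, contr_tmul]
  apply one_tmul_mem_superIdeal_of_map_eq_zero
  have h := restrict_contr (⟨w, hw⟩ : W) (1 ⊗ₜ (ω * ExteriorAlgebra.ι ℂ v))
  rwa [contr_tmul, restrict_tmul, restrict_tmul, map_one, one_smul, one_smul,
    map_restrictForm_eq_zero ((finrank_span_normals A).trans_lt A.rank.lt_succ_self)
      (mul_ι_mem_exteriorPower hω v), map_zero, LinearMap.zero_apply] at h

lemma lin_pow_mul_one_tmul_mem_superIdeal (hω : ω ∈ ⋀[ℂ]^A.rank (Fin n → ℂ)) (v : Fin n → ℂ) :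
    lin v ^ max (countNe A.normals v) 1 * 1 ⊗ₜ ω ∈ A.superIdeal := by
  by_cases h₀ : countNe A.normals v = 0
  · have h := lin_pow_mem_superIdeal A v
    rw [h₀, zero_add] at h
    rw [h₀, max_eq_right zero_le_one, (lin_pow_commute v 1 _).eq]
    exact A.superIdeal.mul_mem_left _ h
  rw [max_eq_left (Nat.one_le_iff_ne_zero.2 h₀)]
  obtain ⟨w, hw, hwv⟩ := exists_mem_span_dotProduct_ne_zero h₀
  -- `(w ⬝ᵥ v) • ω` is the sum of `contr w (ω * form v)` and `contr w ω * form v`.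
  have h₁ := A.superIdeal.mul_mem_left (lin v ^ countNe A.normals v)
    (contr_mul_form_mem_superIdeal hω hw v)
  have h₂ := A.superIdeal.mul_mem_left (contr w (1 ⊗ₜ ω)) (lin_pow_mul_form_mem_superIdeal A v)
  rw [← mul_assoc, ← (lin_pow_commute v _ _).eq, mul_assoc] at h₂
  have hsum := A.superIdeal.add_mem h₁ h₂
  rw [← mul_add, contr_mul_form, sub_add_cancel, mul_smul_comm] at hsum
  exact ((A.superIdeal.restrictScalars ℂ).smul_mem_iff hwv).1 hsum

lemma tmul_mem_superIdeal_of_mem_essCentralIdeal (hω : ω ∈ ⋀[ℂ]^A.rank (Fin n → ℂ))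
    {f : MvPolynomial (Fin n) ℂ} (hf : f ∈ A.essCentralIdeal) : f ⊗ₜ ω ∈ A.superIdeal := by
  induction hf using Submodule.span_induction with
  | mem x hx =>
    obtain ⟨v, -, rfl⟩ := hx
    have h := lin_pow_mul_one_tmul_mem_superIdeal hω v
    rw [lin_pow, Algebra.TensorProduct.tmul_mul_tmul, mul_one, one_mul] at h
    rwa [A.rho_span_singleton]
  | zero => rw [TensorProduct.zero_tmul]; exact zero_mem _
  | add x y _ _ hx hy => rw [TensorProduct.add_tmul]; exact add_mem hx hy
  | smul p x _ hx => simpa using A.superIdeal.mul_mem_left (p ⊗ₜ 1) hx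

end TopForms

lemma mul_linearForm_pow_mem_essCentralIdeal (p : MvPolynomial (Fin n) ℂ) (v : Fin n → ℂ) {k : ℕ}
    (hk : max (countNe A.normals v) 1 ≤ k) : p * linearForm v ^ k ∈ A.essCentralIdeal := by
  rcases eq_or_ne v 0 with rfl | hv
  · have hk₀ : k ≠ 0 := by omega
    simp [linearForm, hk₀]
  · obtain ⟨c, rfl⟩ := Nat.exists_eq_add_of_le' hk
    rw [pow_add, ← mul_assoc]
    exact Ideal.mul_mem_left _ _ (Ideal.subset_span ⟨v, hv, by rw [A.rho_span_singleton]⟩)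

lemma polyPart_mem_essCentralIdeal {φ : Module.Dual ℂ (ExteriorAlgebra ℂ (Fin n → ℂ))}
    (hφ : ∀ v, countNe A.normals v = 0 → ∀ ω, φ (ω * ExteriorAlgebra.ι ℂ v) = 0) {i j : ℕ}
    {a : Superspace n} (ha : a ∈ bidegree n i j) (haI : a ∈ A.superIdeal) :
    polyPart φ a ∈ A.essCentralIdeal := by
  suffices powerPiece ⊥ A.normals i j ≤ (A.essCentralIdeal.restrictScalars ℂ).comap (polyPart φ)
    from this (mem_powerPiece_of_mem_superIdeal A ha haI)
  rw [powerPiece, Submodule.span_le]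
  rintro _ ⟨v, -, ⟨k, g, -, -, rfl⟩ | ⟨k, l, g, -, -, -, rfl⟩⟩ <;>
    rw [SetLike.mem_coe, Submodule.mem_comap]
  · rw [polyPart_mul_lin_pow]
    exact mul_linearForm_pow_mem_essCentralIdeal A _ v (by omega)
  · by_cases h₀ : countNe A.normals v = 0
    · rw [polyPart_mul_form_eq_zero φ (hφ v h₀)]
      exact zero_mem _
    · rw [mul_assoc, (lin_pow_commute v _ _).eq, ← mul_assoc, polyPart_mul_lin_pow]
      exact mul_linearForm_pow_mem_essCentralIdeal A _ v (by omega)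

theorem quotientPieceDim_bidegree_rank (i : ℕ) :
    quotientPieceDim A.superIdeal (bidegree n i A.rank) =
      quotientPieceDim A.essCentralIdeal (homogeneousSubmodule (Fin n) ℂ i) := by
  set W := Submodule.span ℂ {b | b ∈ A.normals}
  obtain ⟨e, he, φ, hφe, hφ⟩ := exists_dual_injective_of_finrank_eq_one
    (V := ⋀[ℂ]^A.rank (Module.Dual ℂ W)) (by
      rw [exteriorPower.finrank_eq, Subspace.dual_finrank_eq, finrank_span_normals,
        Nat.choose_self])
  have hmap := map_exteriorPower_of_surjective (restrictForm_surjective W) A.rank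
  obtain ⟨ω, hω, rfl⟩ := hmap.ge he
  refine quotientPieceDim_bidegree_eq
    (φ := φ ∘ₗ (ExteriorAlgebra.map (restrictForm W)).toLinearMap) hω hφe
    (fun η hη hη₀ => one_tmul_mem_superIdeal_of_map_eq_zero A
      (hφ _ (hmap.le ⟨η, hη, rfl⟩) hη₀))
    (fun f hf => tmul_mem_superIdeal_of_mem_essCentralIdeal hω hf)
    (fun a ha haI => polyPart_mem_essCentralIdeal A (fun v hv η => ?_) ha haI)
  have hv₀ : restrictForm W v = 0 := countNe_eq_zero_iff.1 hv
  simp [hv₀]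

lemma powerIdeal_zero_eq_essCentralIdeal (h : A.rank = n) :
    A.powerIdeal 0 = A.essCentralIdeal := by
  have htop : Submodule.span ℂ {b | b ∈ A.normals} = ⊤ := by
    apply Submodule.eq_top_of_finrank_eq
    rw [finrank_span_normals, h, Module.finrank_fin_fun]
  have hone_le {l : Fin n → ℂ} (hl : l ≠ 0) : 1 ≤ A.rho (Submodule.span ℂ {l}) := by
    rw [A.rho_span_singleton, Nat.one_le_iff_ne_zero]
    refine fun h₀ => hl (dotProduct_eq_zero_iff.1 fun w => ?_)
    rw [dotProduct_comm]
    exact mem_ker_restrictForm.1 (countNe_eq_zero_iff.1 h₀) w (htop ▸ Submodule.mem_top)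
  rw [Multiarrangement.powerIdeal, Multiarrangement.essCentralIdeal]
  congr 1
  ext f
  refine exists_congr fun l => and_congr_right fun hl => ?_
  rw [add_zero, max_eq_left (hone_le hl)]

end Superspace

/-! ### Top total degree -/

lemma homogeneousComponent_succ_X_mul {σ R : Type*} [CommSemiring R] (s : σ) (k : ℕ)
    (p : MvPolynomial σ R) :
    MvPolynomial.homogeneousComponent (k + 1) (MvPolynomial.X s * p) =
      MvPolynomial.X s * MvPolynomial.homogeneousComponent k p := by
  classical
  ext d
  simp only [MvPolynomial.coeff_homogeneousComponent, MvPolynomial.coeff_X_mul']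
  by_cases hs : s ∈ d.support
  · have hle : Finsupp.single s 1 ≤ d :=
      Finsupp.single_le_iff.2 (Nat.one_le_iff_ne_zero.2 (Finsupp.mem_support_iff.1 hs))
    have hdeg : (d - Finsupp.single s 1).degree + 1 = d.degree := by
      conv_rhs => rw [← tsub_add_cancel_of_le hle, map_add, Finsupp.degree_single]
    simp only [hs, if_true, ← hdeg, add_left_inj]
  · simp only [hs, if_false, ite_self]

lemma coeff_aeval_X_zero (P : MvPolynomial (Fin 2) ℕ) (i : ℕ) :
    PowerSeries.coeff i (MvPolynomial.aeval ![(PowerSeries.X : PowerSeries ℕ), 0] P) =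
      MvPolynomial.coeff (qtExp i 0) P := by
  induction P using MvPolynomial.induction_on' with
  | monomial e c =>
    have he : e = qtExp i 0 ↔ e 0 = i ∧ e 1 = 0 := by
      simp [qtExp, Finsupp.ext_iff, Fin.forall_fin_two]
    simp only [MvPolynomial.aeval_monomial, MvPolynomial.coeff_monomial, he,
      Finsupp.prod_fintype _ _ fun _ => pow_zero _, Fin.prod_univ_two, Matrix.cons_val_zero,
      Matrix.cons_val_one, PowerSeries.algebraMap_apply, PowerSeries.coeff_C_mul]
    by_cases h₁ : e 1 = 0
    · simp [h₁, PowerSeries.coeff_X_pow, eq_comm]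
    · simp [h₁]
  | add p q hp hq => rw [map_add, map_add, MvPolynomial.coeff_add, hp, hq]

lemma toRatQT_eq_eval₂ (P : MvPolynomial (Fin 2) ℕ) :
    toRatQT P = P.eval₂ (Nat.castRingHom RatQT) ![qVar, tVar] := by
  induction P using MvPolynomial.induction_on with
  | C c => simp [toRatQT]
  | add p q hp hq =>
    rw [MvPolynomial.eval₂_add, ← hp, ← hq, toRatQT, map_add, map_add, toRatQT, toRatQT]
  | mul_X p s hp =>
    rw [MvPolynomial.eval₂_mul, ← hp, MvPolynomial.eval₂_X, toRatQT, map_mul, map_mul, toRatQT]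
    fin_cases s <;> rfl

lemma qVar_ne_zero : qVar ≠ 0 := by
  simp [qVar, toRatQT]

lemma tVar_ne_zero : tVar ≠ 0 := by
  simp [tVar, toRatQT]

namespace Multiarrangement

variable {n m : ℕ} (A : Multiarrangement n m)

lemma rk_le_rank (S : Finset (Fin m)) : A.rk S ≤ A.rank :=
  Submodule.finrank_mono (Submodule.span_mono (Set.image_mono (by simp)))

lemma rank_le : A.rank ≤ m := by
  rw [rank, rk, Finset.coe_univ, Set.image_univ]
  exact (finrank_range_le_card A.normal).trans_eq (Fintype.card_fin m)

end Multiarrangement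

namespace Superspace

open MvPolynomial

variable {n m : ℕ}

lemma totalDegree_one_add_X_one_pow_le (k : ℕ) :
    ((1 + X 1 : MvPolynomial (Fin 2) ℕ) ^ k).totalDegree ≤ k := by
  have h : (1 + X 1 : MvPolynomial (Fin 2) ℕ).totalDegree ≤ 1 :=
    (totalDegree_add _ _).trans (by simp)
  exact (totalDegree_pow _ _).trans (by simpa using Nat.mul_le_mul_left k h)

lemma homogeneousComponent_one_add_X_one_pow (k : ℕ) :
    homogeneousComponent k ((1 + X 1 : MvPolynomial (Fin 2) ℕ) ^ k) = X 1 ^ k := by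
  induction k with
  | zero => simp
  | succ k ih =>
    rw [pow_succ', add_mul, one_mul, map_add, homogeneousComponent_succ_X_mul, ih, pow_succ',
      homogeneousComponent_eq_zero _ _ (Nat.lt_succ_of_le (totalDegree_one_add_X_one_pow_le k)),
      zero_add]

lemma totalDegree_hilbPoly_le (A : List (Fin n → ℂ)) (W : Submodule ℂ (Fin n → ℂ)) :
    (hilbPoly A W).totalDegree ≤ A.length + Module.finrank ℂ W := by
  induction A generalizing W with
  | nil => simpa [hilbPoly] using totalDegree_one_add_X_one_pow_le _
  | cons b A ih =>
    rw [hilbPoly, List.length_cons]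
    split_ifs with hb
    · exact (ih W).trans (by lia)
    · have hdel : (X 0 * hilbPoly A W).totalDegree ≤ 1 + (A.length + Module.finrank ℂ W) :=
        (totalDegree_mul _ _).trans (add_le_add (totalDegree_X 0).le (ih W))
      have hcontr := ih (W ⊔ Submodule.span ℂ {b})
      rw [Submodule.finrank_sup_span_singleton hb] at hcontr
      exact (totalDegree_add _ _).trans (max_le (hdel.trans (by lia)) (hcontr.trans (by lia)))

lemma coeff_hilbPoly_length_zero_ne_zero {A : List (Fin n → ℂ)} (hA : ∀ b ∈ A, b ≠ 0) :
    coeff (qtExp A.length 0) (hilbPoly A ⊥) ≠ 0 := by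
  induction A with
  | nil => simp [hilbPoly, coeff_qtExp_one]
  | cons b A ih =>
    have hb : b ∉ (⊥ : Submodule ℂ (Fin n → ℂ)) := hA b List.mem_cons_self
    have h := ih fun x hx => hA x (List.mem_cons_of_mem _ hx)
    rw [hilbPoly, if_neg hb, List.length_cons, coeff_add, coeff_qtExp_succ_X_zero_mul]
    lia

lemma totalDegree_hilbPoly {A : List (Fin n → ℂ)} (hA : ∀ b ∈ A, b ≠ 0) :
    (hilbPoly A ⊥).totalDegree = A.length := by
  refine le_antisymm (by simpa using totalDegree_hilbPoly_le A ⊥) ?_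
  have h := le_totalDegree (mem_support_iff.2 (coeff_hilbPoly_length_zero_ne_zero hA))
  rw [Finsupp.sum_fintype _ _ (fun _ => rfl)] at h
  simpa [Fin.sum_univ_two, qtExp] using h

/-- The homogeneous component of `hilbPoly A W` in degree `|A| + dim W`, the largest degree that
can occur. -/
def hilbTop (A : List (Fin n → ℂ)) (W : Submodule ℂ (Fin n → ℂ)) : MvPolynomial (Fin 2) ℕ :=
  homogeneousComponent (A.length + Module.finrank ℂ W) (hilbPoly A W)

lemma hilbTop_nil (W : Submodule ℂ (Fin n → ℂ)) : hilbTop [] W = X 1 ^ Module.finrank ℂ W := by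
  rw [hilbTop, hilbPoly, List.length_nil, zero_add, homogeneousComponent_one_add_X_one_pow]

section Cons

variable {b : Fin n → ℂ} {W : Submodule ℂ (Fin n → ℂ)}

lemma hilbTop_cons_of_mem (A : List (Fin n → ℂ)) (hb : b ∈ W) : hilbTop (b :: A) W = 0 := by
  rw [hilbTop, hilbPoly, if_pos hb, List.length_cons]
  exact homogeneousComponent_eq_zero _ _ ((totalDegree_hilbPoly_le A W).trans_lt (by lia))

lemma hilbTop_cons_of_notMem (A : List (Fin n → ℂ)) (hb : b ∉ W) :
    hilbTop (b :: A) W = X 0 * hilbTop A W + hilbTop A (W ⊔ Submodule.span ℂ {b}) := by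
  rw [hilbTop, hilbPoly, if_neg hb, List.length_cons, map_add, add_right_comm,
    homogeneousComponent_succ_X_mul, hilbTop, hilbTop, Submodule.finrank_sup_span_singleton hb,
    add_assoc]

end Cons

section SignedSum

variable {K : Type*} [Field K] {q : K}

theorem eval₂_hilbTop_map {ι : Type*} [DecidableEq ι] (hq : q ≠ 0) (t : K)
    (a : ι → Fin n → ℂ) {l : List ι} (hl : l.Nodup) (W : Submodule ℂ (Fin n → ℂ)) :
    (hilbTop (l.map a) W).eval₂ (Nat.castRingHom K) ![q, t] =
      ∑ S ∈ l.toFinset.powerset, (-1) ^ S.card *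
        ((-1) ^ Module.finrank ℂ W * q ^ (l.length + Module.finrank ℂ W) *
          (-(t / q)) ^ Module.finrank ℂ ↥(W ⊔ Submodule.span ℂ (a '' S))) := by
  induction l generalizing W with
  | nil =>
    have ht : -1 * q * -(t / q) = t := by field_simp
    have hspan : W ⊔ Submodule.span ℂ (a '' ↑(∅ : Finset ι)) = W := by simp
    rw [List.toFinset_nil, Finset.powerset_empty, Finset.sum_singleton, hspan, List.length_nil,
      zero_add, ← mul_pow, ← mul_pow, ht]
    simp [hilbTop_nil]
  | cons i l ih =>
    obtain ⟨hi, hl⟩ := List.nodup_cons.1 hl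
    have hi' : i ∉ l.toFinset := by rwa [List.mem_toFinset]
    have hcard : ∀ S ∈ l.toFinset.powerset, (insert i S).card = S.card + 1 := fun S hS =>
      Finset.card_insert_of_notMem fun h => hi' (Finset.mem_powerset.1 hS h)
    have hspan (S : Finset ι) : W ⊔ Submodule.span ℂ (a '' ↑(insert i S)) =
        W ⊔ Submodule.span ℂ {a i} ⊔ Submodule.span ℂ (a '' S) := by
      rw [Finset.coe_insert, Set.image_insert_eq, Submodule.span_insert, sup_assoc]
    rw [List.toFinset_cons, Finset.sum_powerset_insert hi', List.map_cons]
    by_cases hb : a i ∈ W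
    · -- The subsets `S` and `insert i S` contribute opposite terms.
      rw [hilbTop_cons_of_mem _ hb, eval₂_zero, ← Finset.sum_add_distrib, eq_comm]
      refine Finset.sum_eq_zero fun S hS => ?_
      rw [hcard S hS, hspan, sup_eq_left.2 (Submodule.span_singleton_le_iff_mem _ _ |>.2 hb)]
      ring
    · rw [hilbTop_cons_of_notMem _ hb, eval₂_add, eval₂_mul, eval₂_X, ih hl, ih hl, Finset.mul_sum,
        Submodule.finrank_sup_span_singleton hb, List.length_cons]
      congr 1 <;> refine Finset.sum_congr rfl fun S hS => ?_
      · rw [Matrix.cons_val_zero]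
        ring
      · rw [hcard S hS, hspan]
        ring

variable (A : Multiarrangement n m)

lemma eval₂_hilbTop_normals (hq : q ≠ 0) (t : K) :
    (hilbTop A.normals ⊥).eval₂ (Nat.castRingHom K) ![q, t] =
      ∑ S : Finset (Fin m), (-1) ^ S.card * (q ^ m * (-(t / q)) ^ A.rk S) := by
  have huniv : (List.finRange m).toFinset.powerset = Finset.univ := by ext; simp
  rw [Multiarrangement.normals, List.ofFn_eq_map,
    eval₂_hilbTop_map hq t A.normal (List.nodup_finRange m) ⊥, huniv]
  refine Finset.sum_congr rfl fun S _ => ?_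
  rw [bot_sup_eq, Multiarrangement.rk]
  simp

theorem eval₂_hilbTop_normals_eq_charPoly [Algebra ℤ K] (hq : q ≠ 0) {t : K}
    (ht : t ≠ 0) :
    (hilbTop A.normals ⊥).eval₂ (Nat.castRingHom K) ![q, t] =
      (-1) ^ A.rank * q ^ (m - A.rank) * t ^ A.rank *
        Polynomial.aeval (-(q / t)) A.charPoly := by
  have hinv : -(t / q) * -(q / t) = 1 := by field_simp
  have hqt : q * -(t / q) = -1 * t := by field_simp
  have hpow (S : Finset (Fin m)) :
      (-(t / q)) ^ A.rk S = (-(t / q)) ^ A.rank * (-(q / t)) ^ (A.rank - A.rk S) := by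
    rw [← pow_mul_pow_sub _ (A.rk_le_rank S), mul_assoc, ← mul_pow, hinv, one_pow, mul_one]
  have hscale : q ^ m * (-(t / q)) ^ A.rank = (-1) ^ A.rank * q ^ (m - A.rank) * t ^ A.rank := by
    rw [← pow_sub_mul_pow q A.rank_le, mul_assoc, ← mul_pow, hqt, mul_pow]
    ring
  rw [eval₂_hilbTop_normals A hq, Multiarrangement.charPoly, map_sum, Finset.mul_sum, ← hscale]
  refine Finset.sum_congr rfl fun S _ => ?_
  rw [hpow, map_mul, map_pow, map_pow, map_neg, map_one, Polynomial.aeval_X]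
  ring

end SignedSum

lemma toRatQT_topPart_hilbPoly_normals (A : Multiarrangement n m) :
    toRatQT (topPart (hilbPoly A.normals ⊥)) =
      (-1) ^ A.rank * qVar ^ (m - A.rank) * tVar ^ A.rank *
        Polynomial.aeval (-(qVar / tVar)) A.charPoly := by
  have hA : ∀ b ∈ A.normals, b ≠ 0 := by
    intro b hb
    obtain ⟨i, rfl⟩ := (List.mem_ofFn' _ _).1 hb
    exact A.normal_ne_zero i
  have htop : topPart (hilbPoly A.normals ⊥) = hilbTop A.normals ⊥ := by
    rw [topPart, totalDegree_hilbPoly hA, hilbTop, finrank_bot, add_zero]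
  rw [htop, toRatQT_eq_eval₂]
  exact eval₂_hilbTop_normals_eq_charPoly A qVar_ne_zero tVar_ne_zero

lemma coe_hilbPoly_normals (A : Multiarrangement n m) :
    (hilbPoly A.normals ⊥ : MvPowerSeries (Fin 2) ℕ) = A.hilbE := by
  ext e
  rw [coeff_coe]
  change _ = quotientPieceDim A.superIdeal (bidegree n (e 0) (e 1))
  rw [quotientPieceDim_superIdeal, qtExp_apply_zero_one]

lemma tCoeff_hilbE (A : Multiarrangement n m) (j : ℕ) :
    tCoeff j A.hilbE = PowerSeries.mk fun i => quotientPieceDim A.superIdeal (bidegree n i j) := by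
  ext i
  rw [tCoeff, ← coe_hilbPoly_normals, PowerSeries.coeff_mk, PowerSeries.coeff_mk, coeff_coe,
    quotientPieceDim_superIdeal, qtExp]

end Superspace

theorem corollary4p4 (n m : ℕ) (A : Multiarrangement n m) :
    ∃ P : MvPolynomial (Fin 2) ℕ,
      (P : MvPowerSeries (Fin 2) ℕ) = A.hilbE ∧
      MvPolynomial.aeval ![(PowerSeries.X : PowerSeries ℕ), 0] P = hilb (A.powerIdeal 1) ∧
      (A.rank = n → tCoeff A.rank A.hilbE = hilb (A.powerIdeal 0)) ∧
      tCoeff A.rank A.hilbE = hilb A.essCentralIdeal ∧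
      toRatQT (topPart P) =
        (-1) ^ A.rank * qVar ^ (m - A.rank) * tVar ^ A.rank *
          Polynomial.aeval (-(qVar / tVar)) A.charPoly := by
  have hcentral : tCoeff A.rank A.hilbE = hilb A.essCentralIdeal := by
    simp only [Superspace.tCoeff_hilbE, Superspace.quotientPieceDim_bidegree_rank, hilb]
  refine ⟨Superspace.hilbPoly A.normals ⊥, Superspace.coe_hilbPoly_normals A, ?_,
    fun hrank => ?_, hcentral, Superspace.toRatQT_topPart_hilbPoly_normals A⟩
  · ext i
    rw [coeff_aeval_X_zero, ← Superspace.quotientPieceDim_superIdeal,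
      Superspace.quotientPieceDim_bidegree_zero, hilb, PowerSeries.coeff_mk]
  · rw [hcentral, Superspace.powerIdeal_zero_eq_essCentralIdeal A hrank]

end
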